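/- \textbf{Exponential advantage for near-term quantum principal component analysis.} Let $n>1$ and let $Z_1$ be the Pauli-$Z$ operator on the first qubit. For $\gamma>0$ let $\mathcal S_n(\gamma)$ be the set of $n$-qubit density matrices $\rho$ having an eigenvector $|\phi\rangle$ whose eigenvalue exceeds all the other eigenvalues of $\rho$ (counted with multiplicity) by at least $\gamma$. An algorithm that learns about an unknown state through $T$ rounds of experiments on $k$ copies is a tree of depth $T$: at each node it jointly measures $k$ fresh copies of $\rho$ by a POVM with finitely many outcomes, the outcome determines the next node (so the POVM may depend on all earlier outcomes), and at a leaf it outputs a real number; it uses $kT$ copies in total. It is \emph{conventional} if $k=1$; a \emph{quantum-enhanced} algorithm may take $k>1$. We say that it \emph{succeeds with gap $\gamma$} if for every $\rho\in\mathcal S_n(\gamma)$ its output is, with probability at least $0.8$, within $0.25$ of $\operatorname{tr}(Z_1\rho^2)/\operatorname{tr}(\rho^2)$. \begin{itemize} \item \emph{Upper bound.} For every $\gamma>0$ there is a number $N$, depending only on $\gamma$, such that for every $n>1$ some quantum-enhanced algorithm using $2N=\mathcal O(1)$ copies of $\rho$ succeeds with gap $\gamma$. Moreover, it can be chosen so that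 it holds only two copies at a time, and in each of its $N$ rounds performs the same entangling measurement on $\rho\otimes\rho$: the $k$-th qubits of the two copies are measured in the Bell basis for each $k\ge 2$, and the two first qubits in the basis $|00\rangle$, $|11\rangle$, $(|01\rangle\pm|10\rangle)/\sqrt2$. \item \emph{Lower bound.} There is an absolute constant $c>0$ such that for every $n>1$ and every $0<\gamma\le \frac12-2^{-n}$, every conventional algorithm that succeeds with gap $\gamma$ uses at least $c\,2^{n/2}$ copies of $\rho$. (In particular the bound is $\Omega(2^{n/2})$ for each constant gap $\gamma<\frac12$, and holds for all $n>1$ if $\gamma\le\frac14$.) \end{itemize} -/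

import Mathlib

open scoped BigOperators Matrix ComplexOrder

noncomputable section

/-- Labels of the computational basis of `n` qubits; the first qubit has index `0`. -/
abbrev Qubits (n : ℕ) : Type := Fin n → Fin 2

/-- Density matrices (mixed states) on `ℂ^ι`. -/
def IsDensityMatrix {ι : Type} [Fintype ι] (ρ : Matrix ι ι ℂ) : Prop :=
  ρ.PosSemidef ∧ ρ.trace = 1

/-- Some eigenvector `φ` of `ρ` has an eigenvalue that exceeds by at least `γ` all the other
eigenvalues, that is, the eigenvalues (with multiplicity) on the orthogonal complement of `φ`. -/
def HasSpectralGap {ι : Type} [Fintype ι] (ρ : Matrix ι ι ℂ) (γ : ℝ) : Prop :=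
  ∃ (φ : ι → ℂ) (top : ℝ), φ ≠ 0 ∧ ρ *ᵥ φ = (top : ℂ) • φ ∧
    ∀ (v : ι → ℂ) (μ : ℝ), v ≠ 0 → star φ ⬝ᵥ v = 0 → ρ *ᵥ v = (μ : ℂ) • v → μ + γ ≤ top

/-- The Pauli-`Z` operator acting on the `k`-th of `n` qubits. -/
def pauliZ {n : ℕ} (k : Fin n) : Matrix (Qubits n) (Qubits n) ℂ :=
  Matrix.diagonal fun x => if x k = 0 then 1 else -1

/-- The quantity `tr(O ρ²) / tr(ρ²)`. -/
def squaredExpectation {ι : Type} [Fintype ι] [DecidableEq ι] (O ρ : Matrix ι ι ℂ) : ℝ :=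
  ((O * ρ ^ 2).trace / (ρ ^ 2).trace).re

/-- The state `ρ ⊗ ⋯ ⊗ ρ` of `k` copies of `ρ`. -/
def tensorPower {ι : Type} (k : ℕ) (ρ : Matrix ι ι ℂ) : Matrix (Fin k → ι) (Fin k → ι) ℂ :=
  Matrix.of fun x y => ∏ i, ρ (x i) (y i)

/-- A POVM on `ℂ^ι` with outcomes in the finite set `Ω`. -/
structure POVM (ι Ω : Type) [Fintype ι] [DecidableEq ι] [Fintype Ω] where
  effect : Ω → Matrix ι ι ℂ
  posSemidef : ∀ s, (effect s).PosSemidef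
  sum_eq_one : ∑ s, effect s = 1

/-- The probability of the outcome `s` when the POVM `F` is measured on the state `σ`. -/
def POVM.prob {ι Ω : Type} [Fintype ι] [DecidableEq ι] [Fintype Ω] (F : POVM ι Ω)
    (σ : Matrix ι ι ℂ) (s : Ω) : ℝ :=
  (F.effect s * σ).trace.re

/-- Learning trees of depth `T`.  In each of the `T` rounds the algorithm takes `k` fresh copies of
the unknown `n`-qubit state and measures them jointly by a POVM; the POVM may depend on all earlier
outcomes, because it is attached to the node that has been reached.  At a leaf the algorithm outputs
a real number.  In total `k * T` copies are consumed.  Using one outcome set `Ω` for all nodes is no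
restriction, since the effect of an outcome may be `0`, and classical randomness can be
absorbed into the outcomes. -/
inductive LearningTree (n k : ℕ) (Ω : Type) [Fintype Ω] : ℕ → Type
  | leaf (output : ℝ) : LearningTree n k Ω 0
  | node {T : ℕ} (F : POVM (Fin k → Qubits n) Ω) (next : Ω → LearningTree n k Ω T) :
      LearningTree n k Ω (T + 1)

/-- Algorithms in the conventional scenario using `T` copies: the copies are measured one at a time,
adaptively, and only classical outcomes are kept. -/
abbrev ConventionalAlgorithm (n : ℕ) (Ω : Type) [Fintype Ω] (T : ℕ) : Type :=
  LearningTree n 1 Ω T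

/-- Algorithms in the quantum-enhanced scenario that store `k` copies at a time in quantum memory,
measure them jointly, and do this `N` times; they use `k * N` copies. -/
abbrev QuantumEnhancedAlgorithm (n k : ℕ) (Ω : Type) [Fintype Ω] (N : ℕ) : Type :=
  LearningTree n k Ω N

/-- The probability that the output lies in `S` when the unknown state is `ρ`. -/
def LearningTree.outputProb {n k : ℕ} {Ω : Type} [Fintype Ω]
    (ρ : Matrix (Qubits n) (Qubits n) ℂ) (S : Set ℝ) :
    {T : ℕ} → LearningTree n k Ω T → ℝ
  | _, .leaf a => S.indicator 1 a
  | _, .node F next => ∑ s, F.prob (tensorPower k ρ) s * (next s).outputProb ρ S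

/-- Every round of the algorithm performs the measurement `F`. -/
def LearningTree.MeasuresOnly {n k : ℕ} {Ω : Type} [Fintype Ω] (F : POVM (Fin k → Qubits n) Ω) :
    {T : ℕ} → LearningTree n k Ω T → Prop
  | _, .leaf _ => True
  | _, .node G next => G = F ∧ ∀ s, (next s).MeasuresOnly F

/-- For every `n`-qubit state with spectral gap at least `γ`, the algorithm predicts
`tr(O ρ²) / tr(ρ²)` up to error `0.25` with probability at least `0.8`. -/
def LearningTree.Predicts {n k : ℕ} {Ω : Type} [Fintype Ω] {T : ℕ} (A : LearningTree n k Ω T)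
    (O : Matrix (Qubits n) (Qubits n) ℂ) (γ : ℝ) : Prop :=
  ∀ ρ : Matrix (Qubits n) (Qubits n) ℂ, IsDensityMatrix ρ → HasSpectralGap ρ γ →
    0.8 ≤ A.outputProb ρ {x | |x - squaredExpectation O ρ| ≤ 0.25}

/-- The Bell basis of two qubits, in coordinates: `(|00⟩ + |11⟩)/√2`, `(|00⟩ - |11⟩)/√2`,
`(|01⟩ + |10⟩)/√2`, `(|01⟩ - |10⟩)/√2`. -/
def bellBasis : Fin 4 → Fin 2 → Fin 2 → ℂ :=
  ![![![1 / √2, 0], ![0, 1 / √2]],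
    ![![1 / √2, 0], ![0, -1 / √2]],
    ![![0, 1 / √2], ![1 / √2, 0]],
    ![![0, 1 / √2], ![-1 / √2, 0]]]

/-- The basis `|00⟩`, `|11⟩`, `(|01⟩ + |10⟩)/√2`, `(|01⟩ - |10⟩)/√2` of two qubits, which
diagonalizes the swap as well as `Z ⊗ I + I ⊗ Z`. -/
def swapZBasis : Fin 4 → Fin 2 → Fin 2 → ℂ :=
  ![![![1, 0], ![0, 0]],
    ![![0, 0], ![0, 1]],
    ![![0, 1 / √2], ![1 / √2, 0]],
    ![![0, 1 / √2], ![-1 / √2, 0]]]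

/-- The basis in which the `k`-th qubits of the two copies are measured. -/
def pairBasis {n : ℕ} (k : Fin n) : Fin 4 → Fin 2 → Fin 2 → ℂ :=
  if (k : ℕ) = 0 then swapZBasis else bellBasis

/-- The vector `⊗ₖ |b(k, s k)⟩` on two copies of `n` qubits, where `|b(k, 0)⟩, …, |b(k, 3)⟩` is the
basis chosen for the pair of `k`-th qubits. -/
def virtualDistillationVector {n : ℕ} (s : Fin n → Fin 4) : (Fin 2 → Qubits n) → ℂ :=
  fun x => ∏ k, pairBasis k (s k) (x 0 k) (x 1 k)

theorem inv_sqrt_two_mul_self : ((√2 : ℝ) : ℂ)⁻¹ * ((√2 : ℝ) : ℂ)⁻¹ = 1 / 2 := by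
  rw [← mul_inv, ← Complex.ofReal_mul, Real.mul_self_sqrt (by norm_num)]
  norm_num

theorem pairBasis_complete {n : ℕ} (k : Fin n) (a b c d : Fin 2) :
    ∑ s, pairBasis k s a b * star (pairBasis k s c d) = if a = c ∧ b = d then 1 else 0 := by
  have h := inv_sqrt_two_mul_self
  unfold pairBasis
  split_ifs with hk hac hac <;> revert hac <;>
    fin_cases a <;> fin_cases b <;> fin_cases c <;> fin_cases d <;>
    simp [swapZBasis, bellBasis, Fin.sum_univ_four, neg_div, h] <;> norm_num

theorem virtualDistillationVector_complete (n : ℕ) :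
    ∑ s : Fin n → Fin 4, Matrix.vecMulVec (virtualDistillationVector s)
      (star (virtualDistillationVector s)) = 1 := by
  ext x y
  rw [Matrix.sum_apply]
  simp only [Matrix.vecMulVec_apply, virtualDistillationVector, Pi.star_apply, star_prod,
    ← Finset.prod_mul_distrib]
  rw [← Fintype.piFinset_univ, ← Finset.prod_univ_sum (fun _ => Finset.univ)
    (fun k s => pairBasis k s (x 0 k) (x 1 k) * star (pairBasis k s (y 0 k) (y 1 k)))]
  simp only [pairBasis_complete]
  rw [Matrix.one_apply, Finset.prod_ite_zero]
  have : (∀ i : Fin n, x 0 i = y 0 i ∧ x 1 i = y 1 i) ↔ x = y := by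
    constructor
    · intro h
      funext j i
      have := h i
      fin_cases j
      · exact this.1
      · exact this.2
    · rintro rfl i
      exact ⟨rfl, rfl⟩
  simp [this]

/-- The entangling two-copy measurement of virtual distillation: for every `k > 0` the `k`-th qubits
of the two copies are measured in the Bell basis, and the first qubits (those on which `Z` acts)
in the Bell-type basis `|00⟩`, `|11⟩`, `(|01⟩ ± |10⟩)/√2`. -/
def virtualDistillationPOVM (n : ℕ) : POVM (Fin 2 → Qubits n) (Fin n → Fin 4) where
  effect s := Matrix.vecMulVec (virtualDistillationVector s) (star (virtualDistillationVector s))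
  posSemidef _ := Matrix.posSemidef_vecMulVec_self_star _
  sum_eq_one := virtualDistillationVector_complete n

end

open MeasureTheory MvPolynomial ComplexConjugate

/-! Lower bound. Put `d = 2 ^ (n - 1)` and hide a random pure state `z` in one eigenspace of `Z₁`,
mixed equally with the maximally mixed state of the other eigenspace. The target value is `± (d - 1)
/ (d + 1)`, the sign telling which eigenspace holds `z`, whereas the average over `z` is maximally
mixed for both signs. One must show that single-copy measurements barely see more than this average.
Take `z` Gaussian and unnormalized, so that every quantity is homogeneous. The probability of an
outcome is then a sum of squared moduli of linear forms in `z`, and a path through the tree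
contributes squared norms of products of such forms in Fock space. The commutation relations give
`‖ℓ P‖² ≥ ‖ℓ‖² ‖P‖²` (`mul_fockNormSq_le_fockNormSq_linearForm_mul`), so by induction on the tree an
event is, on average over `z`, at least as probable as for the averaged state
(`fockNormSq_mul_outputProb_le`). The only loss is in normalization: `d (d + 1) ⋯ (d + T - 1)`
against `d ^ T`, a factor at most `exp (T ^ 2 / d)`. Failure has probability at most `0.2` for each
sign, and the two failure events cover everything, so `1 ≤ 0.4 * exp (T ^ 2 / d)`. This forces `T`
to be of order `√d`. Upper bound. The measurement diagonalizes the swap `S` and `S (Z₁ ⊗ I + I ⊗ Z₁)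
/ 2`, whose means on `ρ ⊗ ρ` are `tr ρ²` and `tr (Z₁ ρ²)`. Empirical means of these bounded
observables concentrate by Chebyshev (`le_outputProb_ratioTree`). Their ratio is stable because a
gap `γ` forces `tr ρ² ≥ γ²`. -/

/-! ### Gaussian moments on the complex plane -/

theorem integrable_pow_mul_conj_pow_mul_exp (a b : ℕ) :
    Integrable fun z : ℂ => z ^ a * conj z ^ b * (Real.exp (-‖z‖ ^ 2) : ℂ) := by
  have h : Integrable fun z : ℂ => ‖z‖ ^ ((a + b : ℕ) : ℝ) * Real.exp (-‖z‖ ^ (2 : ℝ)) := by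
    -- The Bochner integral of a non-integrable function is `0`, so the nonzero value given by the
    -- Gamma formula already proves integrability.
    refine .of_integral_ne_zero ?_
    rw [Complex.integral_rpow_mul_exp_neg_rpow (by norm_num)
      (by have : (0 : ℝ) ≤ (a + b : ℕ) := Nat.cast_nonneg _
          linarith)]
    have : 0 < Real.Gamma ((((a + b : ℕ) : ℝ) + 2) / 2) := Real.Gamma_pos_of_pos (by positivity)
    positivity
  refine h.mono' (Continuous.aestronglyMeasurable (by fun_prop)) (.of_forall fun z => ?_)
  rw [norm_mul, norm_mul, norm_pow, norm_pow, RCLike.norm_conj, ← pow_add, Complex.norm_real,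
    Real.norm_eq_abs, Real.abs_exp, Real.rpow_natCast, Real.rpow_two]

theorem integral_pow_mul_conj_pow_mul_exp (a b : ℕ) :
    ∫ z : ℂ, z ^ a * conj z ^ b * (Real.exp (-‖z‖ ^ 2) : ℂ) =
      if a = b then (Real.pi * a.factorial : ℂ) else 0 := by
  split_ifs with hab
  · subst hab
    have h := Complex.integral_rpow_mul_exp_neg_rpow (p := 2) (q := (2 * a : ℕ)) (by norm_num)
      (by have : (0 : ℝ) ≤ (2 * a : ℕ) := Nat.cast_nonneg _
          linarith)
    have e : (((2 * a : ℕ) : ℝ) + 2) / 2 = a + 1 := by push_cast; ring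
    rw [e, Real.Gamma_nat_eq_factorial] at h
    have h' := congrArg (fun x : ℝ => (x : ℂ)) h
    simp only [← integral_complex_ofReal] at h'
    refine Eq.trans (integral_congr_ae (.of_forall fun z => ?_)) (h'.trans ?_)
    · simp only [Real.rpow_natCast, Real.rpow_two, ← mul_pow, Complex.mul_conj, pow_mul]
      rw [Complex.normSq_eq_norm_sq]
      push_cast
      ring_nf
    · push_cast
      ring
  · have hne : ((a : ℝ) - b) ≠ 0 := sub_ne_zero.2 (by exact_mod_cast hab)
    -- Rotating by the angle `π / (a - b)` multiplies the integrand by `-1` and preserves the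
    -- measure, so the integral equals its own negative.
    set c : Circle := Circle.exp (Real.pi / (a - b))
    have hc : (c : ℂ) ^ a * conj (c : ℂ) ^ b = -1 := by
      rw [← Circle.coe_inv_eq_conj, ← Circle.exp_neg, Circle.coe_exp, Circle.coe_exp,
        ← Complex.exp_nat_mul, ← Complex.exp_nat_mul, ← Complex.exp_add, ← Complex.exp_pi_mul_I]
      congr 1
      have hne' : ((a : ℂ) - b) ≠ 0 := by exact_mod_cast hne
      push_cast
      field_simp
      ring
    have h := (LinearIsometryEquiv.measurePreserving (rotation c)).integral_comp'
      (f := (rotation c).toMeasurableEquiv)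
      (fun z : ℂ => z ^ a * conj z ^ b * (Real.exp (-‖z‖ ^ 2) : ℂ))
    have h2 : (∫ z : ℂ, -(z ^ a * conj z ^ b * (Real.exp (-‖z‖ ^ 2) : ℂ))) =
        ∫ z : ℂ, z ^ a * conj z ^ b * (Real.exp (-‖z‖ ^ 2) : ℂ) := by
      refine Eq.trans (integral_congr_ae (.of_forall fun z => ?_)) h
      simp only [LinearIsometryEquiv.coe_toMeasurableEquiv, LinearIsometryEquiv.norm_map]
      rw [rotation_apply, map_mul, mul_pow, mul_pow]
      linear_combination (-(z ^ a * conj z ^ b * (Real.exp (-‖z‖ ^ 2) : ℂ))) * hc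
    rw [integral_neg] at h2
    linear_combination (-1 / 2 : ℂ) * h2

/-! ### The Fock inner product on polynomials -/

section Fock

variable {σ : Type} [Fintype σ]

/-- The unnormalized Gaussian weight on `ℂ^σ`. -/
noncomputable def gaussianWeight (z : σ → ℂ) : ℝ := Real.exp (-∑ k, ‖z k‖ ^ 2)

theorem gaussianWeight_pos (z : σ → ℂ) : 0 < gaussianWeight z := Real.exp_pos _

theorem continuous_gaussianWeight : Continuous (gaussianWeight (σ := σ)) := by
  unfold gaussianWeight
  fun_prop

/-- The inner product of the Fock space, on polynomials. -/
noncomputable def fockInner (P Q : MvPolynomial σ ℂ) : ℂ :=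
  ∫ z : σ → ℂ, eval z P * conj (eval z Q) * (gaussianWeight z : ℂ)

theorem monomial_mul_conj_monomial_mul_gaussianWeight (a b : σ →₀ ℕ) (c d : ℂ) (z : σ → ℂ) :
    eval z (monomial a c) * conj (eval z (monomial b d)) * (gaussianWeight z : ℂ) =
      c * conj d * ∏ k, (z k ^ a k * conj (z k) ^ b k * (Real.exp (-‖z k‖ ^ 2) : ℂ)) := by
  rw [eval_monomial, eval_monomial, gaussianWeight, ← Finset.sum_neg_distrib, Real.exp_sum,
    Finsupp.prod_fintype _ _ (fun _ => pow_zero _), Finsupp.prod_fintype _ _ (fun _ => pow_zero _),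
    Finset.prod_mul_distrib, Finset.prod_mul_distrib, map_mul, map_prod]
  simp only [map_pow]
  push_cast
  ring

theorem integrable_mul_conj_mul_gaussianWeight (P Q : MvPolynomial σ ℂ) :
    Integrable fun z : σ → ℂ => eval z P * conj (eval z Q) * (gaussianWeight z : ℂ) := by
  induction P using MvPolynomial.induction_on' with
  | add p q hp hq =>
    refine (hp.add hq).congr (.of_forall fun z => ?_)
    simp only [Pi.add_apply, map_add]
    ring
  | monomial a c =>
    induction Q using MvPolynomial.induction_on' with
    | add p q hp hq =>
      refine (hp.add hq).congr (.of_forall fun z => ?_)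
      simp only [Pi.add_apply, map_add]
      ring
    | monomial b d =>
      simp only [monomial_mul_conj_monomial_mul_gaussianWeight]
      refine Integrable.const_mul ?_ _
      exact Integrable.fintype_prod (f := fun k (w : ℂ) =>
        w ^ a k * conj w ^ b k * (Real.exp (-‖w‖ ^ 2) : ℂ))
        fun k => integrable_pow_mul_conj_pow_mul_exp (a k) (b k)

theorem fockInner_add_left (P Q R : MvPolynomial σ ℂ) :
    fockInner (P + Q) R = fockInner P R + fockInner Q R := by
  unfold fockInner
  rw [← integral_add (integrable_mul_conj_mul_gaussianWeight P R)
    (integrable_mul_conj_mul_gaussianWeight Q R)]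
  simp only [map_add, add_mul]

theorem fockInner_add_right (P Q R : MvPolynomial σ ℂ) :
    fockInner P (Q + R) = fockInner P Q + fockInner P R := by
  unfold fockInner
  rw [← integral_add (integrable_mul_conj_mul_gaussianWeight P Q)
    (integrable_mul_conj_mul_gaussianWeight P R)]
  simp only [map_add, add_mul, mul_add]

theorem fockInner_C_mul_left (c : ℂ) (P Q : MvPolynomial σ ℂ) :
    fockInner (C c * P) Q = c * fockInner P Q := by
  unfold fockInner
  rw [← integral_const_mul]
  simp only [map_mul, eval_C, mul_assoc]

theorem fockInner_C_mul_right (c : ℂ) (P Q : MvPolynomial σ ℂ) :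
    fockInner P (C c * Q) = conj c * fockInner P Q := by
  unfold fockInner
  rw [← integral_const_mul]
  refine integral_congr_ae (.of_forall fun z => ?_)
  simp only [map_mul, eval_C]
  ring

theorem fockInner_sum_left {κ : Type*} (s : Finset κ) (P : κ → MvPolynomial σ ℂ)
    (Q : MvPolynomial σ ℂ) : fockInner (∑ i ∈ s, P i) Q = ∑ i ∈ s, fockInner (P i) Q := by
  classical
  induction s using Finset.induction_on with
  | empty => simp [fockInner]
  | insert i s hi ih => rw [Finset.sum_insert hi, Finset.sum_insert hi, fockInner_add_left, ih]

theorem fockInner_sum_right {κ : Type*} (s : Finset κ) (P : MvPolynomial σ ℂ)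
    (Q : κ → MvPolynomial σ ℂ) : fockInner P (∑ i ∈ s, Q i) = ∑ i ∈ s, fockInner P (Q i) := by
  classical
  induction s using Finset.induction_on with
  | empty => simp [fockInner]
  | insert i s hi ih => rw [Finset.sum_insert hi, Finset.sum_insert hi, fockInner_add_right, ih]

theorem fockInner_monomial (a b : σ →₀ ℕ) (c d : ℂ) :
    fockInner (monomial a c) (monomial b d) =
      c * conj d * ∏ k, if a k = b k then (Real.pi * (a k).factorial : ℂ) else 0 := by
  unfold fockInner
  simp only [monomial_mul_conj_monomial_mul_gaussianWeight]
  rw [integral_const_mul, integral_fintype_prod_volume_eq_prod (fun k (w : ℂ) =>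
    w ^ a k * conj w ^ b k * (Real.exp (-‖w‖ ^ 2) : ℂ))]
  simp only [integral_pow_mul_conj_pow_mul_exp]

/-- Multiplication by a variable is adjoint to the derivative. -/
theorem fockInner_X_mul (k : σ) (P Q : MvPolynomial σ ℂ) :
    fockInner (X k * P) Q = fockInner P (pderiv k Q) := by
  classical
  induction P using MvPolynomial.induction_on' with
  | add p q hp hq => rw [mul_add, fockInner_add_left, fockInner_add_left, hp, hq]
  | monomial a c =>
    induction Q using MvPolynomial.induction_on' with
    | add p q hp hq => rw [map_add, fockInner_add_right, fockInner_add_right, hp, hq]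
    | monomial b d =>
      rw [pderiv_monomial, X, monomial_mul, fockInner_monomial, fockInner_monomial,
        Fintype.prod_eq_mul_prod_compl k, Fintype.prod_eq_mul_prod_compl k, map_mul,
        Complex.conj_natCast]
      have h : ∏ j ∈ ({k}ᶜ : Finset σ), (if (Finsupp.single k 1 + a : σ →₀ ℕ) j = b j then
            (Real.pi * ((Finsupp.single k 1 + a : σ →₀ ℕ) j).factorial : ℂ) else 0) =
          ∏ j ∈ ({k}ᶜ : Finset σ), (if a j = (b - Finsupp.single k 1 : σ →₀ ℕ) j then
            (Real.pi * (a j).factorial : ℂ) else 0) := by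
        refine Finset.prod_congr rfl fun j hj => ?_
        have : k ≠ j := by
          rintro rfl
          simp at hj
        simp [Finsupp.single_eq_of_ne, this.symm]
      rw [h]
      simp only [Finsupp.add_apply, Finsupp.tsub_apply, Finsupp.single_eq_same]
      -- When `b k = 0` the exponent `b k - 1` is truncated, but the factor `b k` coming from the
      -- derivative vanishes.
      rcases Nat.eq_zero_or_pos (b k) with h0 | h0
      · simp [h0]
      · have : (1 + a k = b k) ↔ (a k = b k - 1) := by omega
        simp only [this]
        split_ifs with h1
        · have h2 : b k = a k + 1 := by omega
          rw [h2, add_comm 1 (a k), Nat.factorial_succ]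
          push_cast
          ring
        · ring

end Fock

/-! ### Commutation relations and radial moments in Fock space -/

section FockNorm

variable {σ : Type} [Fintype σ]

/-- The squared norm of the Fock space, on polynomials. -/
noncomputable def fockNormSq (P : MvPolynomial σ ℂ) : ℝ :=
  ∫ z : σ → ℂ, ‖eval z P‖ ^ 2 * gaussianWeight z

theorem norm_sq_mul_gaussianWeight_eq (P : MvPolynomial σ ℂ) (z : σ → ℂ) :
    ((‖eval z P‖ ^ 2 * gaussianWeight z : ℝ) : ℂ) =
      eval z P * conj (eval z P) * (gaussianWeight z : ℂ) := by
  rw [Complex.mul_conj, Complex.normSq_eq_norm_sq]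
  push_cast
  rfl

theorem integrable_norm_sq_mul_gaussianWeight (P : MvPolynomial σ ℂ) :
    Integrable fun z : σ → ℂ => ‖eval z P‖ ^ 2 * gaussianWeight z := by
  refine ((integrable_mul_conj_mul_gaussianWeight P P).re).congr (.of_forall fun z => ?_)
  simp only [← norm_sq_mul_gaussianWeight_eq]
  exact Complex.ofReal_re _

theorem fockInner_self (P : MvPolynomial σ ℂ) : fockInner P P = (fockNormSq P : ℂ) := by
  unfold fockInner fockNormSq
  rw [← integral_complex_ofReal]
  exact integral_congr_ae (.of_forall fun z => (norm_sq_mul_gaussianWeight_eq P z).symm)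

theorem fockNormSq_nonneg (P : MvPolynomial σ ℂ) : 0 ≤ fockNormSq P :=
  integral_nonneg fun z => mul_nonneg (sq_nonneg _) (gaussianWeight_pos z).le

theorem fockNormSq_one_pos : 0 < fockNormSq (1 : MvPolynomial σ ℂ) := by
  have h : fockInner (1 : MvPolynomial σ ℂ) 1 = ((Real.pi ^ Fintype.card σ : ℝ) : ℂ) := by
    have := fockInner_monomial (σ := σ) 0 0 1 1
    simpa using this
  rw [fockInner_self, Complex.ofReal_inj] at h
  rw [h]
  positivity

theorem conj_fockInner (P Q : MvPolynomial σ ℂ) : conj (fockInner P Q) = fockInner Q P := by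
  unfold fockInner
  rw [← integral_conj]
  refine integral_congr_ae (.of_forall fun z => ?_)
  simp only [map_mul, Complex.conj_conj, Complex.conj_ofReal]
  ring

theorem fockInner_X_mul_right (k : σ) (P Q : MvPolynomial σ ℂ) :
    fockInner P (X k * Q) = fockInner (pderiv k P) Q := by
  rw [← conj_fockInner, fockInner_X_mul, conj_fockInner]

/-- The linear form with coefficients `v`. -/
noncomputable def linearForm (v : σ → ℂ) : MvPolynomial σ ℂ := ∑ k, C (v k) * X k

theorem eval_linearForm (v z : σ → ℂ) : eval z (linearForm v) = ∑ k, v k * z k := by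
  simp [linearForm]

theorem pderiv_linearForm (v : σ → ℂ) (k : σ) : pderiv k (linearForm v) = C (v k) := by
  classical
  simp [linearForm, pderiv_X, Pi.single_apply]

/-- The commutation relations of the Fock space. -/
theorem fockNormSq_linearForm_mul (v : σ → ℂ) (P : MvPolynomial σ ℂ) :
    fockNormSq (linearForm v * P) =
      (∑ k, ‖v k‖ ^ 2) * fockNormSq P + fockNormSq (∑ k, C (conj (v k)) * pderiv k P) := by
  have h1 : ∀ k, fockInner P (linearForm v * pderiv k P) =
      ∑ j, conj (v j) * fockInner (pderiv j P) (pderiv k P) := by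
    intro k
    rw [linearForm, Finset.sum_mul, fockInner_sum_right]
    refine Finset.sum_congr rfl fun j _ => ?_
    rw [mul_assoc, fockInner_C_mul_right, fockInner_X_mul_right]
  have h2 : fockInner (linearForm v * P) (linearForm v * P) =
      ∑ k, v k * (conj (v k) * fockInner P P +
        ∑ j, conj (v j) * fockInner (pderiv j P) (pderiv k P)) := by
    conv_lhs => arg 1; rw [linearForm, Finset.sum_mul]
    rw [fockInner_sum_left]
    refine Finset.sum_congr rfl fun k _ => ?_
    rw [mul_assoc, fockInner_C_mul_left, fockInner_X_mul, Derivation.leibniz, smul_eq_mul,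
      smul_eq_mul, pderiv_linearForm, fockInner_add_right, h1, mul_comm P, fockInner_C_mul_right]
    ring
  have h3 : fockInner (∑ k, C (conj (v k)) * pderiv k P) (∑ k, C (conj (v k)) * pderiv k P) =
      ∑ k, v k * ∑ j, conj (v j) * fockInner (pderiv j P) (pderiv k P) := by
    rw [fockInner_sum_right]
    refine Finset.sum_congr rfl fun k _ => ?_
    rw [fockInner_C_mul_right, fockInner_sum_left, Complex.conj_conj]
    congr 1
    exact Finset.sum_congr rfl fun j _ => fockInner_C_mul_left _ _ _
  have h4 : (∑ k, v k * (conj (v k) * fockInner P P)) =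
      ((∑ k, ‖v k‖ ^ 2 : ℝ) : ℂ) * fockInner P P := by
    push_cast
    rw [Finset.sum_mul]
    refine Finset.sum_congr rfl fun k _ => ?_
    rw [← mul_assoc, Complex.mul_conj, Complex.normSq_eq_norm_sq]
    push_cast
    rfl
  simp only [mul_add, Finset.sum_add_distrib] at h2
  rw [← h3, h4, fockInner_self, fockInner_self, fockInner_self] at h2
  exact_mod_cast h2

/-- The commutator contributes `‖v‖² ‖P‖²` and the remaining term is the squared norm of a
derivative. This positivity is the whole source of the lower bound: each measured linear form can be
pulled out of the Gaussian average at no less than its average weight. -/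
theorem mul_fockNormSq_le_fockNormSq_linearForm_mul (v : σ → ℂ) (P : MvPolynomial σ ℂ) :
    (∑ k, ‖v k‖ ^ 2) * fockNormSq P ≤ fockNormSq (linearForm v * P) := by
  rw [fockNormSq_linearForm_mul]
  linarith [fockNormSq_nonneg (∑ k, C (conj (v k)) * pderiv k P)]

/-- Moving each `X k` across the inner product and applying Leibniz leaves one copy of `‖P‖²` per
variable plus the Euler operator, which acts on `P` as the scalar `t`. -/
theorem sum_fockNormSq_X_mul {t : ℕ} {P : MvPolynomial σ ℂ} (hP : P.IsHomogeneous t) :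
    ∑ k, fockNormSq (X k * P) = (Fintype.card σ + t) * fockNormSq P := by
  have h : ∑ k, fockInner (X k * P) (X k * P) = (Fintype.card σ + t) * fockInner P P := by
    have h1 : ∀ k, fockInner (X k * P) (X k * P) =
        fockInner P P + fockInner P (X k * pderiv k P) := by
      intro k
      rw [fockInner_X_mul, Derivation.leibniz, smul_eq_mul, smul_eq_mul, pderiv_X_self, mul_one,
        fockInner_add_right, add_comm]
    have h2 : fockInner P ((t : MvPolynomial σ ℂ) * P) = t * fockInner P P := by
      have := fockInner_C_mul_right (t : ℂ) P P
      simpa using this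
    rw [Finset.sum_congr rfl fun k _ => h1 k, Finset.sum_add_distrib,
      ← fockInner_sum_right _ _ fun k => X k * pderiv k P,
      hP.sum_X_mul_pderiv, nsmul_eq_mul, h2]
    simp
    ring
  simp only [fockInner_self] at h
  exact_mod_cast h

/-- Trades one factor `‖z‖²` for multiplication of `P` by the variables, so radial moments reduce to
Fock norms by induction. -/
theorem norm_sq_pow_succ_mul_eq (T : ℕ) (P : MvPolynomial σ ℂ) (z : σ → ℂ) :
    (∑ k, ‖z k‖ ^ 2) ^ (T + 1) * (‖eval z P‖ ^ 2 * gaussianWeight z) =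
      ∑ k, (∑ k, ‖z k‖ ^ 2) ^ T * (‖eval z (X k * P)‖ ^ 2 * gaussianWeight z) := by
  simp only [map_mul, eval_X, norm_mul, mul_pow]
  rw [← Finset.mul_sum, ← Finset.sum_mul, ← Finset.sum_mul]
  ring

theorem integrable_norm_sq_pow_mul (T : ℕ) (P : MvPolynomial σ ℂ) :
    Integrable fun z : σ → ℂ => (∑ k, ‖z k‖ ^ 2) ^ T * (‖eval z P‖ ^ 2 * gaussianWeight z) := by
  induction T generalizing P with
  | zero => simpa using integrable_norm_sq_mul_gaussianWeight P
  | succ T ih =>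
    simp only [norm_sq_pow_succ_mul_eq]
    exact integrable_finsetSum _ fun k _ => ih (X k * P)

/-- Each factor `‖z‖²` raises the degree of the polynomial by one, and the successive Euler
identities produce the rising factorial. -/
theorem integral_norm_sq_pow_mul (T : ℕ) {t : ℕ} {P : MvPolynomial σ ℂ}
    (hP : P.IsHomogeneous t) :
    ∫ z : σ → ℂ, (∑ k, ‖z k‖ ^ 2) ^ T * (‖eval z P‖ ^ 2 * gaussianWeight z) =
      (∏ i ∈ Finset.range T, ((Fintype.card σ : ℝ) + t + i)) * fockNormSq P := by
  induction T generalizing P t with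
  | zero => simp [fockNormSq]
  | succ T ih =>
    simp only [norm_sq_pow_succ_mul_eq]
    rw [integral_finsetSum _ fun k _ => integrable_norm_sq_pow_mul T (X k * P)]
    rw [Finset.sum_congr rfl fun k _ => ih ((isHomogeneous_X ℂ k).mul hP), ← Finset.mul_sum,
      sum_fockNormSq_X_mul hP, Finset.prod_range_succ']
    push_cast
    simp only [add_zero, ← mul_assoc]
    congr 2
    exact Finset.prod_congr rfl fun i _ => by ring

end FockNorm

/-! ### Positivity, normalization and homogeneity of learning trees -/

section Trees

open scoped MatrixOrder Matrix.Norms.L2Operator in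
theorem Matrix.PosSemidef.exists_eq_conjTranspose_mul_self {ι : Type} [Fintype ι] [DecidableEq ι]
    {A : Matrix ι ι ℂ} (hA : A.PosSemidef) : ∃ B : Matrix ι ι ℂ, A = Bᴴ * B :=
  CStarAlgebra.nonneg_iff_eq_star_mul_self.mp hA.nonneg

theorem tensorPower_mul {ι : Type} [Fintype ι] [DecidableEq ι] (k : ℕ) (A B : Matrix ι ι ℂ) :
    tensorPower k (A * B) = tensorPower k A * tensorPower k B := by
  ext x y
  simp only [tensorPower, Matrix.mul_apply, Matrix.of_apply, ← Finset.prod_mul_distrib]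
  rw [Finset.prod_univ_sum, Fintype.piFinset_univ]

theorem conjTranspose_tensorPower {ι : Type} (k : ℕ) (A : Matrix ι ι ℂ) :
    (tensorPower k A)ᴴ = tensorPower k Aᴴ := by
  ext x y
  simp [tensorPower, Matrix.conjTranspose_apply]

theorem posSemidef_tensorPower {ι : Type} [Fintype ι] [DecidableEq ι] (k : ℕ) {ρ : Matrix ι ι ℂ}
    (hρ : ρ.PosSemidef) : (tensorPower k ρ).PosSemidef := by
  obtain ⟨B, rfl⟩ := hρ.exists_eq_conjTranspose_mul_self
  rw [tensorPower_mul, ← conjTranspose_tensorPower]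
  exact Matrix.posSemidef_conjTranspose_mul_self _

theorem trace_tensorPower {ι : Type} [Fintype ι] [DecidableEq ι] (k : ℕ) (ρ : Matrix ι ι ℂ) :
    (tensorPower k ρ).trace = ρ.trace ^ k := by
  have h := Finset.prod_univ_sum (fun _ : Fin k => (Finset.univ : Finset ι)) (fun _ i => ρ i i)
  rw [Fintype.piFinset_univ] at h
  simpa [Matrix.trace, tensorPower] using h.symm

theorem tensorPower_smul {ι : Type} (k : ℕ) (c : ℂ) (ρ : Matrix ι ι ℂ) :
    tensorPower k (c • ρ) = c ^ k • tensorPower k ρ := by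
  ext x y
  simp [tensorPower, Finset.prod_mul_distrib]

theorem trace_mul_nonneg_of_posSemidef {ι : Type} [Fintype ι] [DecidableEq ι]
    {A B : Matrix ι ι ℂ} (hA : A.PosSemidef) (hB : B.PosSemidef) : 0 ≤ (A * B).trace := by
  obtain ⟨C, rfl⟩ := hA.exists_eq_conjTranspose_mul_self
  rw [Matrix.mul_assoc, Matrix.trace_mul_comm]
  exact (hB.mul_mul_conjTranspose_same C).trace_nonneg

theorem trace_eq_re_of_posSemidef {ι : Type} [Fintype ι] {ρ : Matrix ι ι ℂ}
    (hρ : ρ.PosSemidef) : ρ.trace = (ρ.trace.re : ℂ) :=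
  Complex.ext rfl (Complex.nonneg_iff.1 hρ.trace_nonneg).2.symm

theorem POVM.prob_nonneg {ι Ω : Type} [Fintype ι] [DecidableEq ι] [Fintype Ω] (F : POVM ι Ω)
    {σ : Matrix ι ι ℂ} (hσ : σ.PosSemidef) (s : Ω) : 0 ≤ F.prob σ s :=
  (Complex.nonneg_iff.1 (trace_mul_nonneg_of_posSemidef (F.posSemidef s) hσ)).1

theorem POVM.sum_prob {ι Ω : Type} [Fintype ι] [DecidableEq ι] [Fintype Ω] (F : POVM ι Ω)
    (σ : Matrix ι ι ℂ) : ∑ s, F.prob σ s = σ.trace.re := by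
  simp only [POVM.prob]
  rw [← Complex.re_sum, ← Matrix.trace_sum, ← Finset.sum_mul, F.sum_eq_one, one_mul]

theorem POVM.sum_prob_tensorPower {ι Ω : Type} [Fintype ι] [DecidableEq ι] [Fintype Ω] {k : ℕ}
    (F : POVM (Fin k → ι) Ω) {ρ : Matrix ι ι ℂ} (hρ : ρ.PosSemidef) :
    ∑ s, F.prob (tensorPower k ρ) s = ρ.trace.re ^ k := by
  rw [F.sum_prob, trace_tensorPower, trace_eq_re_of_posSemidef hρ, ← Complex.ofReal_pow,
    Complex.ofReal_re, Complex.ofReal_re]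

variable {n k : ℕ} {Ω : Type} [Fintype Ω]

theorem LearningTree.outputProb_nonneg {T : ℕ} (A : LearningTree n k Ω T)
    {ρ : Matrix (Qubits n) (Qubits n) ℂ} (hρ : ρ.PosSemidef) (S : Set ℝ) :
    0 ≤ A.outputProb ρ S := by
  induction A with
  | leaf a => exact Set.indicator_nonneg (fun _ _ => zero_le_one) a
  | node F next ih =>
    exact Finset.sum_nonneg fun s _ =>
      mul_nonneg (F.prob_nonneg (posSemidef_tensorPower k hρ) s) (ih s)

/-- The state need not have trace one: the Gaussian argument runs the tree on unnormalized states,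
where each round contributes a factor `tr ρ ^ k`. -/
theorem LearningTree.outputProb_add_compl {T : ℕ} (A : LearningTree n k Ω T)
    {ρ : Matrix (Qubits n) (Qubits n) ℂ} (hρ : ρ.PosSemidef) (S : Set ℝ) :
    A.outputProb ρ S + A.outputProb ρ Sᶜ = ρ.trace.re ^ (k * T) := by
  induction A with
  | leaf a =>
    simp [LearningTree.outputProb]
  | @node T F next ih =>
    simp only [LearningTree.outputProb]
    rw [← Finset.sum_add_distrib]
    simp only [← mul_add, ih]
    rw [← Finset.sum_mul, F.sum_prob_tensorPower hρ, ← pow_add]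
    congr 1
    ring

theorem LearningTree.outputProb_le {T : ℕ} (A : LearningTree n k Ω T)
    {ρ : Matrix (Qubits n) (Qubits n) ℂ} (hρ : ρ.PosSemidef) (S : Set ℝ) :
    A.outputProb ρ S ≤ ρ.trace.re ^ (k * T) := by
  rw [← A.outputProb_add_compl hρ S]
  linarith [A.outputProb_nonneg hρ Sᶜ]

theorem LearningTree.outputProb_mono {T : ℕ} (A : LearningTree n k Ω T)
    {ρ : Matrix (Qubits n) (Qubits n) ℂ} (hρ : ρ.PosSemidef) {S S' : Set ℝ} (h : S ⊆ S') :
    A.outputProb ρ S ≤ A.outputProb ρ S' := by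
  induction A with
  | leaf a => exact Set.indicator_le_indicator_of_subset h (fun _ => zero_le_one) a
  | node F next ih =>
    exact Finset.sum_le_sum fun s _ =>
      mul_le_mul_of_nonneg_left (ih s) (F.prob_nonneg (posSemidef_tensorPower k hρ) s)

theorem LearningTree.outputProb_smul {T : ℕ} (A : LearningTree n k Ω T) (c : ℝ)
    (ρ : Matrix (Qubits n) (Qubits n) ℂ) (S : Set ℝ) :
    A.outputProb ((c : ℂ) • ρ) S = c ^ (k * T) * A.outputProb ρ S := by
  induction A with
  | leaf a => simp [LearningTree.outputProb]
  | @node T F next ih =>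
    simp only [LearningTree.outputProb, ih, POVM.prob, tensorPower_smul]
    rw [Finset.mul_sum]
    refine Finset.sum_congr rfl fun s _ => ?_
    rw [Matrix.mul_smul, Matrix.trace_smul, smul_eq_mul, ← Complex.ofReal_pow,
      Complex.re_ofReal_mul]
    ring

theorem LearningTree.continuous_outputProb {X : Type*} [TopologicalSpace X] {T : ℕ}
    (A : LearningTree n k Ω T) {ρ : X → Matrix (Qubits n) (Qubits n) ℂ} (hρ : Continuous ρ)
    (S : Set ℝ) : Continuous fun x => A.outputProb (ρ x) S := by
  induction A with
  | leaf a => exact continuous_const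
  | node F next ih =>
    have h : Continuous fun x => tensorPower k (ρ x) :=
      continuous_matrix fun i j => by
        simp only [tensorPower, Matrix.of_apply]
        exact continuous_finsetProd _ fun l _ => hρ.matrix_elem _ _
    refine continuous_finsetSum _ fun s _ => Continuous.mul ?_ (ih s)
    exact Complex.continuous_re.comp (continuous_const.matrix_mul h).matrix_trace

end Trees

/-! ### Hidden states and the quadratic forms of their outcome probabilities -/

section HiddenState

variable {σ : Type} [Fintype σ]

theorem trace_mul_vecMulVec_star (B : Matrix σ σ ℂ) (z : σ → ℂ) :
    (Bᴴ * B * Matrix.vecMulVec z (star z)).trace = ((∑ r, ‖∑ k, B r k * z k‖ ^ 2 : ℝ) : ℂ) := by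
  rw [Matrix.mul_assoc, Matrix.trace_mul_comm, Matrix.mul_vecMulVec, Matrix.vecMulVec_mul,
    Matrix.trace_vecMulVec, ← Matrix.star_mulVec, dotProduct]
  push_cast
  refine Finset.sum_congr rfl fun r _ => ?_
  rw [Pi.star_apply, Complex.star_def, Complex.mul_conj, Complex.normSq_eq_norm_sq]
  push_cast
  rfl

theorem trace_conjTranspose_mul_self (B : Matrix σ σ ℂ) :
    (Bᴴ * B).trace = ((∑ r, ∑ k, ‖B r k‖ ^ 2 : ℝ) : ℂ) := by
  rw [Matrix.trace_mul_comm, Matrix.trace]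
  push_cast
  refine Finset.sum_congr rfl fun r _ => ?_
  rw [Matrix.diag_apply, Matrix.mul_apply]
  refine Finset.sum_congr rfl fun k _ => ?_
  rw [Matrix.conjTranspose_apply, Complex.star_def, Complex.mul_conj, Complex.normSq_eq_norm_sq]
  push_cast
  rfl

variable {n : ℕ}

/-- The equal mixture of the state `z` on the range of `V` and the maximally mixed state on the
range of `W`, multiplied by `‖z‖²`. -/
noncomputable def hiddenState (V W : Matrix (Qubits n) σ ℂ) (z : σ → ℂ) :
    Matrix (Qubits n) (Qubits n) ℂ :=
  (1 / 2 : ℂ) • (V * Matrix.vecMulVec z (star z) * Vᴴ) +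
    (((∑ k, ‖z k‖ ^ 2) / (2 * Fintype.card σ) : ℝ) : ℂ) • (W * Wᴴ)

theorem posSemidef_hiddenState (V W : Matrix (Qubits n) σ ℂ) (z : σ → ℂ) :
    (hiddenState V W z).PosSemidef := by
  refine Matrix.PosSemidef.add (Matrix.PosSemidef.smul ?_ ?_) (Matrix.PosSemidef.smul ?_ ?_)
  · exact (Matrix.posSemidef_vecMulVec_self_star z).mul_mul_conjTranspose_same V
  · norm_num [Complex.nonneg_iff]
  · exact Matrix.posSemidef_self_mul_conjTranspose W
  · exact Complex.zero_le_real.2 (by positivity)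

theorem continuous_hiddenState (V W : Matrix (Qubits n) σ ℂ) : Continuous (hiddenState V W) := by
  have h : Continuous fun z : σ → ℂ => V * Matrix.vecMulVec z (star z) * Vᴴ :=
    (continuous_const.matrix_mul (continuous_id.matrix_vecMulVec
      (continuous_star.comp continuous_id))).matrix_mul continuous_const
  have h2 : Continuous fun z : σ → ℂ => (∑ k, ‖z k‖ ^ 2) / (2 * Fintype.card σ : ℝ) := by fun_prop
  exact (h.const_smul (1 / 2 : ℂ)).add
    ((Complex.continuous_ofReal.comp h2).smul continuous_const)

theorem trace_vecMulVec_self_star [DecidableEq σ] (z : σ → ℂ) :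
    (Matrix.vecMulVec z (star z)).trace = ((∑ k, ‖z k‖ ^ 2 : ℝ) : ℂ) := by
  have h := trace_mul_vecMulVec_star (1 : Matrix σ σ ℂ) z
  simpa [Matrix.one_apply] using h

theorem trace_hiddenState [DecidableEq σ] [Nonempty σ] {V W : Matrix (Qubits n) σ ℂ} (hV : Vᴴ * V = 1)
    (hW : Wᴴ * W = 1) (z : σ → ℂ) :
    (hiddenState V W z).trace = ((∑ k, ‖z k‖ ^ 2 : ℝ) : ℂ) := by
  have hd : (Fintype.card σ : ℂ) ≠ 0 := by exact_mod_cast Fintype.card_ne_zero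
  rw [hiddenState, Matrix.trace_add, Matrix.trace_smul, Matrix.trace_smul, Matrix.trace_mul_comm,
    ← Matrix.mul_assoc, hV, one_mul, trace_vecMulVec_self_star, Matrix.trace_mul_comm W, hW,
    Matrix.trace_one, smul_eq_mul, smul_eq_mul]
  push_cast
  field_simp
  ring

/-- Since the noise part is scaled by `‖z‖²`, it too is a quadratic form in `z`, namely a multiple
of the identity. The total form is positive, hence `Bᴴ * B`, and its trace is the value of `F` on
the average of the hidden states over a standard Gaussian `z`. -/
theorem exists_trace_mul_hiddenState [DecidableEq σ] [Nonempty σ] (V W : Matrix (Qubits n) σ ℂ)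
    {F : Matrix (Qubits n) (Qubits n) ℂ} (hF : F.PosSemidef) :
    ∃ B : Matrix σ σ ℂ,
      (∀ z, (F * hiddenState V W z).trace = ((∑ r, ‖∑ k, B r k * z k‖ ^ 2 : ℝ) : ℂ)) ∧
      (F * ((1 / 2 : ℂ) • (V * Vᴴ + W * Wᴴ))).trace = ((∑ r, ∑ k, ‖B r k‖ ^ 2 : ℝ) : ℂ) := by
  have hd : (Fintype.card σ : ℂ) ≠ 0 := by exact_mod_cast Fintype.card_ne_zero
  set c : ℂ := (Wᴴ * F * W).trace / (2 * Fintype.card σ) with hc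
  have hG : ((1 / 2 : ℂ) • (Vᴴ * F * V) + c • (1 : Matrix σ σ ℂ)).PosSemidef := by
    refine Matrix.PosSemidef.add (Matrix.PosSemidef.smul (hF.conjTranspose_mul_mul_same V) ?_)
      (Matrix.PosSemidef.smul Matrix.PosSemidef.one ?_)
    · norm_num [Complex.nonneg_iff]
    · rw [hc, trace_eq_re_of_posSemidef (hF.conjTranspose_mul_mul_same W)]
      have := (Complex.nonneg_iff.1 (hF.conjTranspose_mul_mul_same W).trace_nonneg).1
      have h2 : 0 ≤ (Wᴴ * F * W).trace.re / (2 * Fintype.card σ) := by positivity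
      exact_mod_cast h2
  obtain ⟨B, hB⟩ := hG.exists_eq_conjTranspose_mul_self
  have hW : (F * (W * Wᴴ)).trace = (Wᴴ * F * W).trace := by
    rw [← Matrix.mul_assoc, Matrix.trace_mul_comm, Matrix.mul_assoc]
  refine ⟨B, fun z => ?_, ?_⟩
  · have h1 : (F * (V * Matrix.vecMulVec z (star z) * Vᴴ)).trace =
        (Vᴴ * F * V * Matrix.vecMulVec z (star z)).trace := by
      rw [← Matrix.mul_assoc, Matrix.trace_mul_comm]
      simp only [Matrix.mul_assoc]
    rw [← trace_mul_vecMulVec_star, ← hB, hiddenState, Matrix.mul_add, Matrix.trace_add,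
      Matrix.mul_smul, Matrix.mul_smul, Matrix.trace_smul, Matrix.trace_smul, Matrix.add_mul,
      Matrix.smul_mul, Matrix.smul_mul, one_mul, Matrix.trace_add, Matrix.trace_smul,
      Matrix.trace_smul, trace_vecMulVec_self_star, hW, h1, hc]
    simp only [smul_eq_mul]
    push_cast
    field_simp
  · have h1 : (F * (V * Vᴴ)).trace = (Vᴴ * F * V).trace := by
      rw [← Matrix.mul_assoc, Matrix.trace_mul_comm, Matrix.mul_assoc]
    rw [← trace_conjTranspose_mul_self, ← hB, Matrix.mul_smul, Matrix.trace_smul, Matrix.mul_add,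
      Matrix.trace_add, Matrix.trace_add, Matrix.trace_smul, Matrix.trace_smul, Matrix.trace_one,
      hW, h1, hc]
    simp only [smul_eq_mul]
    field_simp

theorem trace_mul_tensorPower_one {ι : Type} [Fintype ι] [DecidableEq ι]
    (F : Matrix (Fin 1 → ι) (Fin 1 → ι) ℂ) (ρ : Matrix ι ι ℂ) :
    (F * tensorPower 1 ρ).trace = (F.submatrix (fun i _ => i) (fun i _ => i) * ρ).trace := by
  let e : ι ≃ (Fin 1 → ι) := (Equiv.funUnique (Fin 1) ι).symm
  have h : tensorPower 1 ρ = ρ.submatrix e.symm e.symm := by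
    ext x y
    simp [tensorPower, e]
  have h2 : F = (F.submatrix e e).submatrix e.symm e.symm := by simp
  conv_lhs => rw [h, h2, Matrix.submatrix_mul_equiv]
  exact e.symm.sum_comp fun i => (F.submatrix e e * ρ) i i

end HiddenState

/-! ### Comparison of hidden states with their average -/

section TreeBound

variable {σ : Type} [Fintype σ] [DecidableEq σ] [Nonempty σ] {n : ℕ} {Ω : Type} [Fintype Ω]

theorem integrable_outputProb_hiddenState {V W : Matrix (Qubits n) σ ℂ} (hV : Vᴴ * V = 1)
    (hW : Wᴴ * W = 1) {T : ℕ} (A : LearningTree n 1 Ω T) (S : Set ℝ) (P : MvPolynomial σ ℂ) :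
    Integrable fun z : σ → ℂ =>
      A.outputProb (hiddenState V W z) S * (‖eval z P‖ ^ 2 * gaussianWeight z) := by
  refine (integrable_norm_sq_pow_mul T P).mono' ?_ (.of_forall fun z => ?_)
  · refine ((A.continuous_outputProb (continuous_hiddenState V W) S).mul
      (Continuous.mul ?_ continuous_gaussianWeight)).aestronglyMeasurable
    exact (MvPolynomial.continuous_eval P).norm.pow 2
  · have hp : 0 ≤ ‖eval z P‖ ^ 2 * gaussianWeight z :=
      mul_nonneg (sq_nonneg _) (gaussianWeight_pos z).le
    have h0 := A.outputProb_nonneg (posSemidef_hiddenState V W z) S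
    have h1 := A.outputProb_le (posSemidef_hiddenState V W z) S
    rw [trace_hiddenState hV hW, Complex.ofReal_re, one_mul] at h1
    rw [Real.norm_eq_abs, abs_of_nonneg (mul_nonneg h0 hp)]
    exact mul_le_mul_of_nonneg_right h1 hp

theorem POVM.exists_prob_hiddenState (V W : Matrix (Qubits n) σ ℂ)
    (F : POVM (Fin 1 → Qubits n) Ω) (s : Ω) :
    ∃ B : Matrix σ σ ℂ,
      (∀ z, F.prob (tensorPower 1 (hiddenState V W z)) s = ∑ r, ‖∑ k, B r k * z k‖ ^ 2) ∧
      F.prob (tensorPower 1 ((1 / 2 : ℂ) • (V * Vᴴ + W * Wᴴ))) s = ∑ r, ∑ k, ‖B r k‖ ^ 2 := by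
  obtain ⟨B, h1, h2⟩ := exists_trace_mul_hiddenState V W
    ((F.posSemidef s).submatrix fun (i : Qubits n) (_ : Fin 1) => i)
  refine ⟨B, fun z => ?_, ?_⟩
  · rw [POVM.prob, trace_mul_tensorPower_one, h1, Complex.ofReal_re]
  · rw [POVM.prob, trace_mul_tensorPower_one, h2, Complex.ofReal_re]

/-- Averaging the hidden state over the Gaussian weight does not decrease, up to normalization, the
probability of any event below its value for the maximally mixed state. -/
theorem fockNormSq_mul_outputProb_le {V W : Matrix (Qubits n) σ ℂ} (hV : Vᴴ * V = 1)
    (hW : Wᴴ * W = 1) {T : ℕ} (A : LearningTree n 1 Ω T) (S : Set ℝ) (P : MvPolynomial σ ℂ) :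
    fockNormSq P * A.outputProb ((1 / 2 : ℂ) • (V * Vᴴ + W * Wᴴ)) S ≤
      ∫ z, A.outputProb (hiddenState V W z) S * (‖eval z P‖ ^ 2 * gaussianWeight z) := by
  have hτ : ((1 / 2 : ℂ) • (V * Vᴴ + W * Wᴴ)).PosSemidef :=
    ((Matrix.posSemidef_self_mul_conjTranspose V).add
      (Matrix.posSemidef_self_mul_conjTranspose W)).smul (by norm_num [Complex.nonneg_iff])
  induction A generalizing P with
  | leaf a =>
    simp only [LearningTree.outputProb]
    rw [integral_const_mul, mul_comm, fockNormSq]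
  | node F next ih =>
    choose B hB1 hB2 using F.exists_prob_hiddenState V W
    -- The outcome probability is a sum of `|ℓ(z)|²`, and each linear form is absorbed into the
    -- polynomial weight. This is why the induction runs over all `P`.
    have key : ∀ z : σ → ℂ, (∑ s, F.prob (tensorPower 1 (hiddenState V W z)) s *
          (next s).outputProb (hiddenState V W z) S) * (‖eval z P‖ ^ 2 * gaussianWeight z) =
        ∑ s, ∑ r, (next s).outputProb (hiddenState V W z) S *
          (‖eval z (linearForm (B s r) * P)‖ ^ 2 * gaussianWeight z) := by
      intro z
      rw [Finset.sum_mul]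
      refine Finset.sum_congr rfl fun s _ => ?_
      simp only [map_mul, eval_linearForm, norm_mul, mul_pow]
      rw [hB1, Finset.sum_mul, Finset.sum_mul]
      refine Finset.sum_congr rfl fun r _ => ?_
      ring
    simp only [LearningTree.outputProb, key]
    rw [integral_finsetSum _ fun s _ => integrable_finsetSum _ fun r _ =>
      integrable_outputProb_hiddenState hV hW (next s) S _, Finset.mul_sum]
    refine Finset.sum_le_sum fun s _ => ?_
    rw [integral_finsetSum _ fun r _ => integrable_outputProb_hiddenState hV hW (next s) S _, hB2,
      Finset.sum_mul, Finset.mul_sum]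
    refine Finset.sum_le_sum fun r _ => ?_
    refine le_trans ?_ (ih s (linearForm (B s r) * P))
    have h := mul_le_mul_of_nonneg_right (mul_fockNormSq_le_fockNormSq_linearForm_mul (B s r) P)
      ((next s).outputProb_nonneg hτ S)
    linarith

/-- The bound for unit vectors extends to all `z ≠ 0` by homogeneity of degree `T` in `‖z‖²`.
Integrating with weight `P = 1` turns `‖z‖ ^ (2 * T)` into the rising factorial. -/
theorem outputProb_maximallyMixed_le {V W : Matrix (Qubits n) σ ℂ} (hV : Vᴴ * V = 1)
    (hW : Wᴴ * W = 1) {T : ℕ} (A : LearningTree n 1 Ω T) (S : Set ℝ) {ε : ℝ}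
    (h : ∀ z : σ → ℂ, ∑ k, ‖z k‖ ^ 2 = 1 → A.outputProb (hiddenState V W z) S ≤ ε) :
    A.outputProb ((1 / 2 : ℂ) • (V * Vᴴ + W * Wᴴ)) S ≤
      ε * ∏ i ∈ Finset.range T, ((Fintype.card σ : ℝ) + i) := by
  have hscale : ∀ z : σ → ℂ, z ≠ 0 →
      A.outputProb (hiddenState V W z) S ≤ ε * (∑ k, ‖z k‖ ^ 2) ^ T := by
    intro z hz
    have hN : 0 < ∑ k, ‖z k‖ ^ 2 := by
      obtain ⟨k, hk⟩ := Function.ne_iff.1 hz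
      exact Finset.sum_pos' (fun _ _ => sq_nonneg _)
        ⟨k, Finset.mem_univ k, pow_pos (norm_pos_iff.2 hk) 2⟩
    set N := ∑ k, ‖z k‖ ^ 2 with hNdef
    have hs : (√N) ^ 2 = N := Real.sq_sqrt hN.le
    have hs0 : 0 < √N := Real.sqrt_pos.2 hN
    set u : σ → ℂ := fun k => ((√N)⁻¹ : ℝ) * z k with hu
    have hnorm : ∑ k, ‖u k‖ ^ 2 = 1 := by
      simp only [hu, norm_mul, mul_pow, Complex.norm_real, Real.norm_eq_abs, sq_abs]
      rw [← Finset.mul_sum, inv_pow, hs, ← hNdef, inv_mul_cancel₀ hN.ne']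
    have hvec : Matrix.vecMulVec z (star z) = (N : ℂ) • Matrix.vecMulVec u (star u) := by
      have hsc : ((√N : ℝ) : ℂ) ^ 2 = N := by exact_mod_cast hs
      have hsc0 : ((√N : ℝ) : ℂ) ≠ 0 := by exact_mod_cast hs0.ne'
      ext i j
      simp only [Matrix.vecMulVec_apply, Matrix.smul_apply, hu, Pi.star_apply, smul_eq_mul,
        star_mul', Complex.star_def, Complex.conj_ofReal, ← hsc]
      push_cast
      field_simp
    have hstate : hiddenState V W z = (N : ℂ) • hiddenState V W u := by
      rw [hiddenState, hiddenState, hnorm, ← hNdef, hvec, smul_add, smul_smul, Matrix.mul_smul,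
        Matrix.smul_mul, smul_smul, smul_smul]
      congr 2
      · ring
      · push_cast
        ring
    rw [hstate, A.outputProb_smul, one_mul, mul_comm]
    exact mul_le_mul_of_nonneg_right (h u hnorm) (by positivity)
  have h1 := fockNormSq_mul_outputProb_le hV hW A S 1
  have h2 : ∫ z, A.outputProb (hiddenState V W z) S *
        (‖eval z (1 : MvPolynomial σ ℂ)‖ ^ 2 * gaussianWeight z) ≤
      ∫ z : σ → ℂ, ε * ((∑ k, ‖z k‖ ^ 2) ^ T *
        (‖eval z (1 : MvPolynomial σ ℂ)‖ ^ 2 * gaussianWeight z)) := by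
    refine integral_mono_ae (integrable_outputProb_hiddenState hV hW A S 1)
      ((integrable_norm_sq_pow_mul T 1).const_mul ε) ?_
    -- The origin cannot be rescaled to a unit vector, but it is a null set.
    filter_upwards [compl_mem_ae_iff.2 (measure_singleton (0 : σ → ℂ))] with z hz
    rw [← mul_assoc ε]
    exact mul_le_mul_of_nonneg_right (hscale z hz)
      (mul_nonneg (sq_nonneg _) (gaussianWeight_pos z).le)
  rw [integral_const_mul, integral_norm_sq_pow_mul T (isHomogeneous_one σ ℂ)] at h2
  have h3 := h1.trans h2
  have hpos := fockNormSq_one_pos (σ := σ)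
  refine le_of_mul_le_mul_left (h3.trans_eq ?_) hpos
  simp only [Nat.cast_zero, add_zero]
  ring

end TreeBound

/-- Each factor satisfies `d + i ≤ d (1 + T / d) ≤ d * exp (T / d)`. -/
theorem prod_add_natCast_le (d : ℝ) (hd : 0 < d) (T : ℕ) :
    ∏ i ∈ Finset.range T, (d + i) ≤ d ^ T * Real.exp (T ^ 2 / d) := by
  have h : ∀ i ∈ Finset.range T, d + (i : ℝ) ≤ d * Real.exp (T / d) := by
    intro i hi
    have h1 : (i : ℝ) ≤ T := by exact_mod_cast (Finset.mem_range.1 hi).le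
    have h2 := mul_le_mul_of_nonneg_left (Real.add_one_le_exp ((T : ℝ) / d)) hd.le
    have h3 : d * ((T : ℝ) / d + 1) = T + d := by field_simp
    linarith
  refine (Finset.prod_le_prod (fun i _ => by positivity) h).trans_eq ?_
  rw [Finset.prod_const, Finset.card_range, mul_pow, ← Real.exp_nat_mul]
  congr 2
  ring

theorem star_dotProduct_self_eq_one {σ : Type} [Fintype σ] {z : σ → ℂ} (hz : ∑ k, ‖z k‖ ^ 2 = 1) :
    star z ⬝ᵥ z = 1 := by
  classical
  have h := trace_vecMulVec_self_star z
  rwa [Matrix.trace_vecMulVec, hz, dotProduct_comm, Complex.ofReal_one] at h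

/-! ### Spectral gap and target value of the hidden states -/

section HiddenProperties

variable {σ : Type} [Fintype σ] [DecidableEq σ] [Nonempty σ] {n : ℕ}

theorem isDensityMatrix_hiddenState {V W : Matrix (Qubits n) σ ℂ} (hV : Vᴴ * V = 1)
    (hW : Wᴴ * W = 1) {z : σ → ℂ} (hz : ∑ k, ‖z k‖ ^ 2 = 1) :
    IsDensityMatrix (hiddenState V W z) :=
  ⟨posSemidef_hiddenState V W z, by rw [trace_hiddenState hV hW, hz, Complex.ofReal_one]⟩

/-- The vector `V z` has eigenvalue `1 / 2`. On its orthogonal complement the state acts as `W Wᴴ /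
(2 d)`, with `d` the cardinality of `σ`, so an eigenvalue there is `1 / (2 d)` or `0`. -/
theorem hasSpectralGap_hiddenState {V W : Matrix (Qubits n) σ ℂ} (hV : Vᴴ * V = 1)
    (hW : Wᴴ * W = 1) (hVW : Wᴴ * V = 0) {z : σ → ℂ} (hz : ∑ k, ‖z k‖ ^ 2 = 1) {γ : ℝ}
    (hγ : γ ≤ 1 / 2 - 1 / (2 * Fintype.card σ)) : HasSpectralGap (hiddenState V W z) γ := by
  have hzz := star_dotProduct_self_eq_one hz
  have hmul : ∀ v : Qubits n → ℂ, hiddenState V W z *ᵥ v =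
      (1 / 2 : ℂ) • ((star z ⬝ᵥ (Vᴴ *ᵥ v)) • (V *ᵥ z)) +
        ((1 / (2 * Fintype.card σ) : ℝ) : ℂ) • (W *ᵥ (Wᴴ *ᵥ v)) := by
    intro v
    rw [hiddenState, hz, Matrix.add_mulVec, Matrix.smul_mulVec, Matrix.smul_mulVec,
      ← Matrix.mulVec_mulVec, ← Matrix.mulVec_mulVec, Matrix.vecMulVec_mulVec,
      ← Matrix.mulVec_mulVec, op_smul_eq_smul, Matrix.mulVec_smul]
  have hVz : Vᴴ *ᵥ (V *ᵥ z) = z := by rw [Matrix.mulVec_mulVec, hV, Matrix.one_mulVec]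
  refine ⟨V *ᵥ z, 1 / 2, ?_, ?_, ?_⟩
  · intro h
    rw [h, Matrix.mulVec_zero] at hVz
    rw [← hVz] at hzz
    simp at hzz
  · rw [hmul, hVz, hzz, Matrix.mulVec_mulVec z, hVW]
    simp
  · intro v μ hv hort hev
    have hort' : star z ⬝ᵥ (Vᴴ *ᵥ v) = 0 := by
      rw [Matrix.dotProduct_mulVec, ← Matrix.star_mulVec]
      exact hort
    rw [hmul, hort', zero_smul, smul_zero, zero_add] at hev
    have h1 : ((1 / (2 * Fintype.card σ) : ℝ) : ℂ) • (Wᴴ *ᵥ v) = (μ : ℂ) • (Wᴴ *ᵥ v) := by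
      have := congrArg (fun u => Wᴴ *ᵥ u) hev
      simpa only [Matrix.mulVec_smul, Matrix.mulVec_mulVec, ← Matrix.mul_assoc, hW,
        Matrix.one_mul] using this
    have hμ : μ ≤ 1 / (2 * Fintype.card σ) := by
      by_cases h0 : Wᴴ *ᵥ v = 0
      · rw [h0, Matrix.mulVec_zero, smul_zero] at hev
        rcases smul_eq_zero.1 hev.symm with h | h
        · rw [Complex.ofReal_eq_zero.1 h]
          positivity
        · exact absurd h hv
      · exact (Complex.ofReal_inj.1 (smul_left_injective ℂ h0 h1)).ge
    linarith

/-- The two parts are orthogonal, so squaring has no cross terms and gives them traces `1 / 4` and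
`d / (4 d²) = 1 / (4 d)`. Squaring suppresses the noise, which is why the sign of the pure part
survives. -/
theorem squaredExpectation_hiddenState {V W : Matrix (Qubits n) σ ℂ} (hV : Vᴴ * V = 1)
    (hW : Wᴴ * W = 1) (hVW : Wᴴ * V = 0) {z : σ → ℂ} (hz : ∑ k, ‖z k‖ ^ 2 = 1)
    {O : Matrix (Qubits n) (Qubits n) ℂ} {s : ℝ} (hOV : O * V = (s : ℂ) • V)
    (hOW : O * W = (-s : ℂ) • W) :
    squaredExpectation O (hiddenState V W z) =
      s * ((Fintype.card σ - 1) / (Fintype.card σ + 1)) := by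
  have hd0 : (0 : ℝ) < Fintype.card σ := by exact_mod_cast Fintype.card_pos
  set d : ℝ := (Fintype.card σ : ℝ) with hd
  have hdc : (d : ℂ) ≠ 0 := by exact_mod_cast hd0.ne'
  have hzz := star_dotProduct_self_eq_one hz
  have hVW' : Vᴴ * W = 0 := by
    have := congrArg Matrix.conjTranspose hVW
    simpa using this
  set M := Matrix.vecMulVec z (star z) with hM
  have hMM : M * M = M := by
    rw [hM, Matrix.vecMulVec_mul_vecMulVec, hzz, one_smul]
  have htrM : M.trace = 1 := by rw [hM, trace_vecMulVec_self_star, hz, Complex.ofReal_one]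
  have hsq : hiddenState V W z ^ 2 =
      (1 / 4 : ℂ) • (V * M * Vᴴ) + (1 / (4 * d ^ 2) : ℂ) • (W * Wᴴ) := by
    have e1 : V * M * Vᴴ * (V * M * Vᴴ) = V * M * Vᴴ := by
      calc _ = V * M * (Vᴴ * V) * M * Vᴴ := by simp only [Matrix.mul_assoc]
        _ = V * (M * M) * Vᴴ := by rw [hV, Matrix.mul_one, Matrix.mul_assoc V]
        _ = _ := by rw [hMM]
    have e2 : V * M * Vᴴ * (W * Wᴴ) = 0 := by
      calc _ = V * M * (Vᴴ * W) * Wᴴ := by simp only [Matrix.mul_assoc]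
        _ = 0 := by rw [hVW', Matrix.mul_zero, Matrix.zero_mul]
    have e3 : W * Wᴴ * (V * M * Vᴴ) = 0 := by
      calc _ = W * (Wᴴ * V) * M * Vᴴ := by simp only [Matrix.mul_assoc]
        _ = 0 := by rw [hVW, Matrix.mul_zero, Matrix.zero_mul, Matrix.zero_mul]
    have e4 : W * Wᴴ * (W * Wᴴ) = W * Wᴴ := by
      calc _ = W * (Wᴴ * W) * Wᴴ := by simp only [Matrix.mul_assoc]
        _ = _ := by rw [hW, Matrix.mul_one]
    rw [hiddenState, hz, ← hM, pow_two, Matrix.add_mul, Matrix.mul_add, Matrix.mul_add]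
    simp only [Matrix.smul_mul, Matrix.mul_smul, e1, e2, e3, e4, smul_zero, add_zero, zero_add,
      smul_smul]
    congr 2
    · norm_num
    · rw [← hd]
      push_cast
      field_simp
      norm_num
  have t1 : (V * M * Vᴴ).trace = 1 := by
    rw [Matrix.trace_mul_comm, ← Matrix.mul_assoc, hV, one_mul, htrM]
  have t2 : (W * Wᴴ).trace = d := by
    rw [Matrix.trace_mul_comm, hW, Matrix.trace_one, hd, Complex.ofReal_natCast]
  have hden : (hiddenState V W z ^ 2).trace = ((1 / 4 + 1 / (4 * d) : ℝ) : ℂ) := by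
    rw [hsq, Matrix.trace_add, Matrix.trace_smul, Matrix.trace_smul, t1, t2]
    simp only [smul_eq_mul]
    push_cast
    field_simp
  have hnum : (O * hiddenState V W z ^ 2).trace = ((s * (1 / 4 - 1 / (4 * d)) : ℝ) : ℂ) := by
    rw [hsq, Matrix.mul_add, Matrix.mul_smul, Matrix.mul_smul, ← Matrix.mul_assoc,
      ← Matrix.mul_assoc, ← Matrix.mul_assoc, hOV, hOW, Matrix.smul_mul, Matrix.smul_mul,
      Matrix.smul_mul, Matrix.trace_add,
      Matrix.trace_smul, Matrix.trace_smul, Matrix.trace_smul, Matrix.trace_smul, t1, t2]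
    simp only [smul_eq_mul]
    push_cast
    field_simp
    ring
  rw [squaredExpectation, hnum, hden, ← Complex.ofReal_div, Complex.ofReal_re]
  field_simp

end HiddenProperties

/-! ### The lower bound for conventional algorithms -/

/-- The isometry that appends a first qubit in the state `b`. -/
def consIsometry (m : ℕ) (b : Fin 2) : Matrix (Qubits (m + 1)) (Qubits m) ℂ :=
  (1 : Matrix (Qubits (m + 1)) (Qubits (m + 1)) ℂ).submatrix id fun y => Fin.cons (α := fun _ => Fin 2) b y

theorem conjTranspose_consIsometry_mul (m : ℕ) (b b' : Fin 2) :
    (consIsometry m b)ᴴ * consIsometry m b' = if b = b' then 1 else 0 := by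
  rw [consIsometry, consIsometry, Matrix.conjTranspose_submatrix, Matrix.conjTranspose_one,
    ← Matrix.submatrix_mul _ _ _ _ _ Function.bijective_id, Matrix.one_mul]
  split_ifs with h
  · subst h
    exact Matrix.submatrix_one _ (Fin.cons_right_injective (α := fun _ => Fin 2) b)
  · ext x y
    rw [Matrix.submatrix_apply, Matrix.zero_apply]
    exact Matrix.one_apply_ne fun hxy => h (by simpa using congrFun hxy 0)

theorem consIsometry_sum (m : ℕ) :
    consIsometry m 0 * (consIsometry m 0)ᴴ + consIsometry m 1 * (consIsometry m 1)ᴴ = 1 := by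
  ext x y
  have h : ∀ b, (consIsometry m b * (consIsometry m b)ᴴ) x y =
      if x 0 = b then (1 : Matrix (Qubits (m + 1)) (Qubits (m + 1)) ℂ) x y else 0 := by
    intro b
    simp only [consIsometry, Matrix.mul_apply, Matrix.submatrix_apply, Matrix.conjTranspose_apply,
      Matrix.one_apply, id]
    have hx : ∀ w : Qubits m, (x = Fin.cons b w) ↔ (x 0 = b ∧ w = Fin.tail x) := by
      intro w
      constructor
      · rintro rfl
        simp
      · rintro ⟨rfl, rfl⟩
        exact (Fin.cons_self_tail x).symm
    rw [Finset.sum_eq_single (Fin.tail x)]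
    · by_cases hb : x 0 = b
      · subst hb
        simp [Fin.cons_self_tail, eq_comm]
      · have : x ≠ Fin.cons (α := fun _ => Fin 2) b (Fin.tail x) := fun h => hb (by rw [h]; simp)
        simp [this, hb]
    · intro w _ hw
      rw [if_neg fun h => hw ((hx w).1 h).2, zero_mul]
    · simp
  rw [Matrix.add_apply, h, h]
  have : x 0 = 0 ∨ x 0 = 1 := by omega
  rcases this with h0 | h0 <;> simp [h0]

theorem pauliZ_mul_consIsometry (m : ℕ) (b : Fin 2) :
    pauliZ (0 : Fin (m + 1)) * consIsometry m b =
      (((if b = 0 then 1 else -1 : ℝ)) : ℂ) • consIsometry m b := by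
  ext x y
  rw [pauliZ, Matrix.diagonal_mul, Matrix.smul_apply, consIsometry, Matrix.submatrix_apply,
    Matrix.one_apply, smul_eq_mul]
  split_ifs <;> simp_all

/-- Correctness on every state hidden behind the first qubit `b` limits failure to `0.2`, and this
transfers to the average `(1 / 2) • 1`. That average has trace `2 ^ m` and does not depend on `b`,
so both signs constrain the same quantity. -/
theorem outputProb_maximallyMixed_compl_le {m : ℕ} {Ω : Type} [Fintype Ω] {T : ℕ}
    (A : ConventionalAlgorithm (m + 1) Ω T) {γ : ℝ} (hγ : γ ≤ 1 / 2 - 1 / 2 ^ (m + 1))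
    (hA : A.Predicts (pauliZ 0) γ) {b b' : Fin 2} (hb : b ≠ b') {s : ℝ}
    (hs : s = if b = 0 then 1 else -1) :
    A.outputProb ((1 / 2 : ℂ) • 1)
        {x | |x - s * ((2 ^ m - 1) / (2 ^ m + 1))| ≤ 0.25}ᶜ ≤
      0.2 * ∏ i ∈ Finset.range T, ((2 : ℝ) ^ m + i) := by
  set V := consIsometry m b
  set W := consIsometry m b'
  have hV : Vᴴ * V = 1 := by simp [V, conjTranspose_consIsometry_mul]
  have hW : Wᴴ * W = 1 := by simp [W, conjTranspose_consIsometry_mul]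
  have hWV : Wᴴ * V = 0 := by simp [V, W, conjTranspose_consIsometry_mul, hb.symm]
  have hsum : V * Vᴴ + W * Wᴴ = 1 := by
    have h : (b = 0 ∧ b' = 1) ∨ (b = 1 ∧ b' = 0) := by omega
    rcases h with ⟨h1, h2⟩ | ⟨h1, h2⟩
    · simp only [V, W, h1, h2, consIsometry_sum]
    · simp only [V, W, h1, h2]
      exact (add_comm _ _).trans (consIsometry_sum m)
  have hcard : (Fintype.card (Qubits m) : ℝ) = 2 ^ m := by simp
  have hOV : pauliZ (0 : Fin (m + 1)) * V = (s : ℂ) • V := by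
    rw [hs]
    exact pauliZ_mul_consIsometry m b
  have hOW : pauliZ (0 : Fin (m + 1)) * W = (-s : ℂ) • W := by
    have h := pauliZ_mul_consIsometry m b'
    have h2 : (if b' = 0 then 1 else -1 : ℝ) = -s := by
      rw [hs]
      have h : (b = 0 ∧ b' = 1) ∨ (b = 1 ∧ b' = 0) := by omega
      rcases h with ⟨h1, h2⟩ | ⟨h1, h2⟩ <;> simp [h1, h2]
    rw [h2] at h
    simpa using h
  have h := outputProb_maximallyMixed_le hV hW A
    {x | |x - s * ((2 ^ m - 1) / (2 ^ m + 1))| ≤ 0.25}ᶜ (ε := 0.2) fun z hz => by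
      have hρ := isDensityMatrix_hiddenState hV hW hz
      have h1 := hA _ hρ (hasSpectralGap_hiddenState hV hW hWV hz (by
        rw [hcard]
        rwa [pow_succ, mul_comm ((2 : ℝ) ^ m)] at hγ))
      rw [squaredExpectation_hiddenState hV hW hWV hz hOV hOW, hcard] at h1
      have h2 := A.outputProb_add_compl hρ.1
        {x | |x - s * ((2 ^ m - 1) / (2 ^ m + 1))| ≤ 0.25}
      rw [hρ.2] at h2
      simp only [Complex.one_re, one_pow] at h2
      norm_num at h1 h2 ⊢
      linarith
  rwa [hsum, hcard] at h

theorem conventional_lower_bound {m : ℕ} (hm : 1 ≤ m) {Ω : Type} [Fintype Ω] {T : ℕ}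
    (A : ConventionalAlgorithm (m + 1) Ω T) {γ : ℝ} (hγ : γ ≤ 1 / 2 - 1 / 2 ^ (m + 1))
    (hA : A.Predicts (pauliZ 0) γ) : 1 / 2 * (2 : ℝ) ^ (((m + 1 : ℕ) : ℝ) / 2) ≤ T := by
  set d : ℝ := 2 ^ m with hd
  have hd2 : 2 ≤ d := by
    calc (2 : ℝ) = 2 ^ 1 := by norm_num
      _ ≤ d := pow_le_pow_right₀ (by norm_num) hm
  set r : ℝ := (d - 1) / (d + 1) with hr
  -- With `n > 1` the two targets `± r` are at least `2 / 3` apart, more than twice the tolerance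
  -- `0.25`, so no output is correct for both.
  have hr3 : 1 / 3 ≤ r := by
    rw [hr, div_le_div_iff₀ (by norm_num) (by linarith)]
    linarith
  have h0 := outputProb_maximallyMixed_compl_le A hγ hA (b := 0) (b' := 1) (by decide) (s := 1)
    (by simp)
  have h1 := outputProb_maximallyMixed_compl_le A hγ hA (b := 1) (b' := 0) (by decide) (s := -1)
    (by simp)
  rw [← hd, ← hr] at h0 h1
  have hτ : ((1 / 2 : ℂ) • (1 : Matrix (Qubits (m + 1)) (Qubits (m + 1)) ℂ)).PosSemidef :=
    Matrix.PosSemidef.one.smul (by norm_num [Complex.nonneg_iff])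
  have htr : ((1 / 2 : ℂ) • (1 : Matrix (Qubits (m + 1)) (Qubits (m + 1)) ℂ)).trace.re = d := by
    have : ((1 / 2 : ℂ) • (1 : Matrix (Qubits (m + 1)) (Qubits (m + 1)) ℂ)).trace =
        ((d : ℝ) : ℂ) := by
      rw [Matrix.trace_smul, Matrix.trace_one, hd]
      simp [pow_succ]
      ring
    rw [this, Complex.ofReal_re]
  have hadd := A.outputProb_add_compl hτ {x | |x - 1 * r| ≤ 0.25}
  rw [htr, one_mul] at hadd
  have hsub : {x : ℝ | |x - 1 * r| ≤ 0.25} ⊆ {x | |x - -1 * r| ≤ 0.25}ᶜ := by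
    intro x hx hx'
    simp only [Set.mem_ofPred_eq, abs_le] at hx hx'
    norm_num at hx hx'
    linarith [hx.1, hx'.2]
  have hmono := A.outputProb_mono hτ hsub
  have hprod := prod_add_natCast_le d (by linarith) T
  have hdT : 0 < d ^ T := by positivity
  -- The two failure events cover all outputs, whose total weight is `d ^ T`; hence `d ^ T ≤ (0.2 +
  -- 0.2) * d ^ T * exp (T ^ 2 / d)`.
  have hexp : 5 / 2 ≤ Real.exp (T ^ 2 / d) := by
    by_contra hlt
    have : d ^ T * Real.exp (T ^ 2 / d) < d ^ T * (5 / 2) :=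
      mul_lt_mul_of_pos_left (not_le.1 hlt) hdT
    simp only [one_mul] at h0 hmono hadd
    linarith
  -- Otherwise `exp (T ^ 2 / d) ^ 2 ≤ e`, which is below `(5 / 2) ^ 2`.
  have hhalf : 1 / 2 ≤ (T : ℝ) ^ 2 / d := by
    by_contra hlt
    have h2 : Real.exp ((T : ℝ) ^ 2 / d) ^ 2 ≤ Real.exp 1 := by
      rw [← Real.exp_nat_mul]
      refine Real.exp_le_exp.2 ?_
      push_cast
      linarith
    have h3 := Real.exp_one_lt_d9
    norm_num at h3
    nlinarith
  rw [div_le_div_iff₀ (by norm_num) (by linarith)] at hhalf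
  have hpow : ((2 : ℝ) ^ (((m + 1 : ℕ) : ℝ) / 2)) ^ 2 = 2 * d := by
    rw [← Real.rpow_natCast, ← Real.rpow_mul (by norm_num), hd]
    push_cast
    rw [div_mul_cancel₀ _ (by norm_num), Real.rpow_add (by norm_num), Real.rpow_one,
      Real.rpow_natCast, mul_comm]
  refine abs_le_of_sq_le_sq' ?_ (Nat.cast_nonneg T) |>.2
  rw [mul_pow, hpow]
  linarith

/-! ### A spectral gap bounds the purity from below -/

section SpectralGap

variable {ι : Type} [Fintype ι] [DecidableEq ι]

/-- With `P` the projector onto `φ`, the squared Hilbert–Schmidt norm of `ρ - t P` is `tr ρ² - t²`,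
hence this is nonnegative. -/
theorem sq_le_trace_sq_of_mulVec_eq_smul {ρ : Matrix ι ι ℂ} (hρ : ρ.IsHermitian) {φ : ι → ℂ}
    (hφ : φ ≠ 0) {t : ℝ} (h : ρ *ᵥ φ = (t : ℂ) • φ) : t ^ 2 ≤ (ρ ^ 2).trace.re := by
  set c : ℂ := star φ ⬝ᵥ φ with hc
  have hc0 : c ≠ 0 := by
    rw [hc]
    exact fun h0 => hφ (dotProduct_star_self_eq_zero.1 h0)
  have hcs : star c = c := by rw [hc, ← Matrix.star_dotProduct_star, star_star, dotProduct_comm]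
  obtain ⟨P, hP⟩ : ∃ P : Matrix ι ι ℂ, P = c⁻¹ • Matrix.vecMulVec φ (star φ) := ⟨_, rfl⟩
  have hPh : Pᴴ = P := by
    rw [hP, Matrix.conjTranspose_smul, Matrix.conjTranspose_vecMulVec, star_star, star_inv₀, hcs]
  have hPt : P.trace = 1 := by
    rw [hP, Matrix.trace_smul, Matrix.trace_vecMulVec, dotProduct_comm, ← hc, smul_eq_mul,
      inv_mul_cancel₀ hc0]
  have hPP : P * P = P := by
    rw [hP, Matrix.smul_mul, Matrix.mul_smul, Matrix.vecMulVec_mul_vecMulVec, ← hc, smul_smul,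
      Matrix.vecMulVec_smul, smul_smul]
    congr 1
    field_simp
  have hρP : ρ * P = (t : ℂ) • P := by
    rw [hP, Matrix.mul_smul, Matrix.mul_vecMulVec, h, Matrix.smul_vecMulVec, smul_comm]
  have hρP' : P * ρ = (t : ℂ) • P := by
    have := congrArg Matrix.conjTranspose hρP
    rwa [Matrix.conjTranspose_mul, Matrix.conjTranspose_smul, hPh, hρ.eq, Complex.star_def,
      Complex.conj_ofReal] at this
  have hD : ((ρ - (t : ℂ) • P)ᴴ * (ρ - (t : ℂ) • P)).trace = (ρ ^ 2).trace - (t : ℂ) ^ 2 := by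
    rw [Matrix.conjTranspose_sub, Matrix.conjTranspose_smul, hPh, hρ.eq, Complex.star_def,
      Complex.conj_ofReal, Matrix.sub_mul, Matrix.mul_sub, Matrix.mul_sub, Matrix.smul_mul,
      Matrix.smul_mul, Matrix.mul_smul, Matrix.mul_smul, hPP, hρP, hρP', ← pow_two]
    simp only [Matrix.trace_sub, Matrix.trace_smul, hPt, smul_eq_mul]
    ring
  have h0 := (Complex.nonneg_iff.1
    (Matrix.posSemidef_conjTranspose_mul_self (ρ - (t : ℂ) • P)).trace_nonneg).1
  rw [hD, ← Complex.ofReal_pow, Complex.sub_re, Complex.ofReal_re] at h0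
  linarith

theorem exists_ne_zero_star_dotProduct_eq_zero [Nontrivial ι] (φ : ι → ℂ) :
    ∃ v : ι → ℂ, v ≠ 0 ∧ star φ ⬝ᵥ v = 0 := by
  obtain ⟨a, b, hab⟩ := exists_pair_ne ι
  by_cases h : φ a = 0
  · exact ⟨Pi.single a 1, by simp, by simp [h]⟩
  · refine ⟨Pi.single a (star (φ b)) - Pi.single b (star (φ a)), fun h0 => h ?_, ?_⟩
    · have := congrFun h0 b
      simpa [hab, hab.symm] using this
    · rw [dotProduct_sub, dotProduct_single, dotProduct_single]
      simp [mul_comm]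

/-- If the gap is `γ`, then the largest eigenvalue is at least `γ`, because the other ones are
nonnegative. -/
theorem HasSpectralGap.sq_le_trace_sq [Nontrivial ι] {ρ : Matrix ι ι ℂ} (hρ : ρ.PosSemidef)
    {γ : ℝ} (hγ : 0 < γ) (h : HasSpectralGap ρ γ) : γ ^ 2 ≤ (ρ ^ 2).trace.re := by
  obtain ⟨φ, t, hφ, hev, hgap⟩ := h
  have hH := hρ.isHermitian
  have ht : γ ≤ t := by
    -- If `ρ = t • 1`, a vector orthogonal to `φ` would have eigenvalue `t`, contradicting the
    -- positive gap. Otherwise an eigenvector with eigenvalue different from `t` is automatically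
    -- orthogonal to `φ`, and its eigenvalue is nonnegative.
    by_cases hall : ∀ i, hH.eigenvalues i = t
    · obtain ⟨v, hv, hvφ⟩ := exists_ne_zero_star_dotProduct_eq_zero φ
      have hρ1 : ρ = (t : ℂ) • (1 : Matrix ι ι ℂ) := by
        have hdiag : Matrix.diagonal (RCLike.ofReal ∘ hH.eigenvalues) =
            (t : ℂ) • (1 : Matrix ι ι ℂ) := by
          rw [Matrix.smul_one_eq_diagonal]
          congr 1
          funext i
          simp [hall i]
        rw [hH.spectral_theorem, hdiag, map_smul, map_one]
      have := hgap v t hv hvφ (by rw [hρ1, Matrix.smul_mulVec, Matrix.one_mulVec])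
      linarith
    · push Not at hall
      obtain ⟨i, hi⟩ := hall
      set u : ι → ℂ := ⇑(hH.eigenvectorBasis i) with hu
      have hu0 : u ≠ 0 := fun h0 => hH.eigenvectorBasis.orthonormal.ne_zero i (by
        ext j
        exact congrFun h0 j)
      have huev : ρ *ᵥ u = ((hH.eigenvalues i : ℝ) : ℂ) • u := by
        have := hH.mulVec_eigenvectorBasis i
        rw [hu, this]
        rfl
      have hort : star φ ⬝ᵥ u = 0 := by
        have h1 : star φ ⬝ᵥ (ρ *ᵥ u) = (t : ℂ) * (star φ ⬝ᵥ u) := by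
          rw [Matrix.dotProduct_mulVec]
          have h2 : star φ ᵥ* ρ = (t : ℂ) • star φ := by
            conv_lhs => rw [← hH.eq]
            rw [← Matrix.star_mulVec, hev, star_smul, Complex.star_def, Complex.conj_ofReal]
          rw [h2, smul_dotProduct, smul_eq_mul]
        rw [huev, dotProduct_smul, smul_eq_mul] at h1
        have h2 : (((hH.eigenvalues i : ℝ) : ℂ) - t) * (star φ ⬝ᵥ u) = 0 := by
          rw [sub_mul, h1, sub_self]
        rcases mul_eq_zero.1 h2 with h3 | h3
        · exact absurd (by exact_mod_cast sub_eq_zero.1 h3) hi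
        · exact h3
      have h1 := hgap u _ hu0 hort huev
      have h2 := hρ.eigenvalues_nonneg i
      linarith
  exact (pow_le_pow_left₀ hγ.le ht 2).trans (sq_le_trace_sq_of_mulVec_eq_smul hH hφ hev)

end SpectralGap

/-! ### Observables read off from the two-copy measurement -/

/-- The eigenvalues of the swap on the measurement basis of a pair of qubits. -/
def swapSign : Fin 4 → ℝ := ![1, 1, 1, -1]

/-- The eigenvalues of `(Z ⊗ I + I ⊗ Z) / 2` on the basis `swapZBasis`. -/
def averageZ : Fin 4 → ℝ := ![1, -1, 0, 0]

/-- Spectral resolution of the swap: both bases consist of symmetric vectors except for the singlet,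
in the last place. -/
theorem sum_swapSign_mul_pairBasis {n : ℕ} (k : Fin n) (a b c d : Fin 2) :
    ∑ s, (swapSign s : ℂ) * (pairBasis k s a b * star (pairBasis k s c d)) =
      if a = d ∧ b = c then 1 else 0 := by
  have h := inv_sqrt_two_mul_self
  unfold pairBasis
  split_ifs with hk hac hac <;> revert hac <;>
    fin_cases a <;> fin_cases b <;> fin_cases c <;> fin_cases d <;>
    simp [swapSign, swapZBasis, bellBasis, Fin.sum_univ_four, neg_div, h] <;> norm_num

/-- The swap and `(Z ⊗ I + I ⊗ Z) / 2` commute and are jointly diagonal in `swapZBasis`. The Bell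
basis would not do, since there the second operator exchanges the first two vectors. -/
theorem sum_swapSign_mul_averageZ_mul_pairBasis {n : ℕ} {k : Fin n} (hk : (k : ℕ) = 0)
    (a b c d : Fin 2) :
    ∑ s, ((swapSign s * averageZ s : ℝ) : ℂ) * (pairBasis k s a b * star (pairBasis k s c d)) =
      (if a = d ∧ b = c then 1 else 0) *
        (((if a = 0 then 1 else -1) + (if b = 0 then 1 else -1)) / 2) := by
  rw [pairBasis, if_pos hk]
  fin_cases a <;> fin_cases b <;> fin_cases c <;> fin_cases d <;>
    simp [swapSign, averageZ, swapZBasis, Fin.sum_univ_four]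

theorem abs_swapSign_le_one (s : Fin 4) : |swapSign s| ≤ 1 := by
  fin_cases s <;> simp [swapSign]

theorem abs_averageZ_le_one (s : Fin 4) : |averageZ s| ≤ 1 := by
  fin_cases s <;> simp [averageZ]

/-- The measured value of the swap of the two copies. -/
def swapValue {n : ℕ} (s : Fin n → Fin 4) : ℝ := ∏ k, swapSign (s k)

theorem abs_swapValue_le_one {n : ℕ} (s : Fin n → Fin 4) : |swapValue s| ≤ 1 := by
  rw [swapValue, Finset.abs_prod]
  exact Finset.prod_le_one (fun _ _ => abs_nonneg _) fun _ _ => abs_swapSign_le_one _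

theorem sum_prod_mul_virtualDistillationPOVM_effect {n : ℕ} (f : Fin n → Fin 4 → ℝ)
    (x y : Fin 2 → Qubits n) :
    ∑ s, ((∏ k, f k (s k) : ℝ) : ℂ) * (virtualDistillationPOVM n).effect s x y =
      ∏ k, ∑ j, (f k j : ℂ) * (pairBasis k j (x 0 k) (x 1 k) *
        star (pairBasis k j (y 0 k) (y 1 k))) := by
  rw [Finset.prod_univ_sum, Fintype.piFinset_univ]
  refine Finset.sum_congr rfl fun s _ => ?_
  simp only [virtualDistillationPOVM, Matrix.vecMulVec_apply, virtualDistillationVector,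
    Pi.star_apply, star_prod, Finset.prod_mul_distrib]
  push_cast
  rfl

theorem prod_swap_indicator {n : ℕ} (x y : Fin 2 → Qubits n) :
    (∏ k, if x 0 k = y 1 k ∧ x 1 k = y 0 k then (1 : ℂ) else 0) =
      if y = ![x 1, x 0] then 1 else 0 := by
  rw [Finset.prod_ite_zero, Finset.prod_const_one]
  have : (∀ k ∈ Finset.univ, x 0 k = y 1 k ∧ x 1 k = y 0 k) ↔ y = ![x 1, x 0] := by
    constructor
    · intro h
      funext j k
      have := h k (Finset.mem_univ k)
      fin_cases j
      · exact this.2.symm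
      · exact this.1.symm
    · rintro rfl k -
      simp
  simp only [this]

/-- The swap trick: the hypothesis says that the observable is the swap times a diagonal operator
`g`, so its trace against `ρ ⊗ ρ` closes into a single loop `ρ a b * ρ b a`. -/
theorem sum_mul_prob_virtualDistillationPOVM {n : ℕ} (ρ : Matrix (Qubits n) (Qubits n) ℂ)
    (f : (Fin n → Fin 4) → ℝ) (g : Qubits n → Qubits n → ℂ)
    (h : ∀ x y : Fin 2 → Qubits n,
      ∑ s, (f s : ℂ) * (virtualDistillationPOVM n).effect s x y =
        (if y = ![x 1, x 0] then 1 else 0) * g (x 0) (x 1)) :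
    ∑ s, (virtualDistillationPOVM n).prob (tensorPower 2 ρ) s * f s =
      (∑ a, ∑ b, g a b * (ρ a b * ρ b a)).re := by
  have h1 : ∑ s, (f s : ℂ) * ((virtualDistillationPOVM n).effect s * tensorPower 2 ρ).trace =
      ∑ a, ∑ b, g a b * (ρ a b * ρ b a) := by
    have h2 : ∀ s, (f s : ℂ) * ((virtualDistillationPOVM n).effect s * tensorPower 2 ρ).trace =
        ∑ x, ∑ y, (f s : ℂ) * (virtualDistillationPOVM n).effect s x y *
          tensorPower 2 ρ y x := by
      intro s
      simp only [Matrix.trace, Matrix.diag_apply, Matrix.mul_apply, Finset.mul_sum, mul_assoc]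
    simp only [h2]
    rw [Finset.sum_comm]
    have h3 : ∀ x : Fin 2 → Qubits n, (∑ s, ∑ y, (f s : ℂ) *
        (virtualDistillationPOVM n).effect s x y * tensorPower 2 ρ y x) =
        g (x 0) (x 1) * (ρ (x 0) (x 1) * ρ (x 1) (x 0)) := by
      intro x
      rw [Finset.sum_comm]
      simp only [← Finset.sum_mul, h]
      rw [Finset.sum_eq_single ![x 1, x 0]]
      · simp only [tensorPower, Matrix.of_apply, Fin.prod_univ_two, if_true, Matrix.cons_val_zero,
          Matrix.cons_val_one]
        ring
      · intro y _ hy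
        simp [hy]
      · simp
    simp only [h3]
    rw [← Fintype.sum_prod_type' (f := fun a b => g a b * (ρ a b * ρ b a))]
    exact Fintype.sum_equiv (finTwoArrowEquiv (Qubits n)) _ _ fun x => rfl
  rw [← h1, Complex.re_sum]
  refine Finset.sum_congr rfl fun s _ => ?_
  rw [Complex.re_ofReal_mul, POVM.prob, mul_comm]

theorem sum_prob_mul_swapValue {n : ℕ} (ρ : Matrix (Qubits n) (Qubits n) ℂ) :
    ∑ s, (virtualDistillationPOVM n).prob (tensorPower 2 ρ) s * swapValue s =
      (ρ ^ 2).trace.re := by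
  rw [sum_mul_prob_virtualDistillationPOVM ρ swapValue (fun _ _ => 1)]
  · simp [pow_two, Matrix.trace, Matrix.mul_apply]
  · intro x y
    simp only [swapValue]
    rw [sum_prod_mul_virtualDistillationPOVM_effect (fun _ => swapSign)]
    simp only [sum_swapSign_mul_pairBasis, prod_swap_indicator, mul_one]

theorem sum_prob_mul_swapValue_mul_averageZ {n : ℕ} (ρ : Matrix (Qubits n) (Qubits n) ℂ)
    {k₀ : Fin n} (hk₀ : (k₀ : ℕ) = 0) :
    ∑ s, (virtualDistillationPOVM n).prob (tensorPower 2 ρ) s *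
      (swapValue s * averageZ (s k₀)) = (pauliZ k₀ * ρ ^ 2).trace.re := by
  set ζ : Qubits n → ℂ := fun a => if a k₀ = 0 then 1 else -1 with hζ
  rw [sum_mul_prob_virtualDistillationPOVM ρ _ (fun a b => (ζ a + ζ b) / 2)]
  · congr 1
    have h1 : (pauliZ k₀ * ρ ^ 2).trace = ∑ a, ∑ b, ζ a * (ρ a b * ρ b a) := by
      simp only [pauliZ, pow_two, Matrix.trace, Matrix.diag_apply, Matrix.diagonal_mul, hζ]
      simp only [Matrix.mul_apply, Finset.mul_sum]
    have h2 : (pauliZ k₀ * ρ ^ 2).trace = ∑ a, ∑ b, ζ b * (ρ a b * ρ b a) := by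
      rw [h1, Finset.sum_comm]
      refine Finset.sum_congr rfl fun a _ => Finset.sum_congr rfl fun b _ => ?_
      ring
    -- The weight `ρ a b * ρ b a` is symmetric, so `Z` may be read on either copy; the measurement
    -- returns the mean of the two readings.
    have h3 : (pauliZ k₀ * ρ ^ 2).trace =
        ((pauliZ k₀ * ρ ^ 2).trace + (pauliZ k₀ * ρ ^ 2).trace) / 2 := by ring
    rw [h3]
    conv_rhs => rw [h2]; arg 1; arg 1; rw [← h2, h1]
    rw [← Finset.sum_add_distrib, Finset.sum_div]
    refine Finset.sum_congr rfl fun a _ => ?_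
    rw [← Finset.sum_add_distrib, Finset.sum_div]
    refine Finset.sum_congr rfl fun b _ => ?_
    ring
  · intro x y
    have h1 : ∀ s : Fin n → Fin 4, swapValue s * averageZ (s k₀) =
        ∏ k, (swapSign (s k) * if k = k₀ then averageZ (s k) else 1) := by
      intro s
      rw [Finset.prod_mul_distrib, Finset.prod_ite_eq' Finset.univ k₀]
      simp [swapValue]
    simp only [h1]
    rw [sum_prod_mul_virtualDistillationPOVM_effect
      (fun k j => swapSign j * if k = k₀ then averageZ j else 1), ← prod_swap_indicator]
    have h2 : ∀ k, ∑ j, ((swapSign j * if k = k₀ then averageZ j else 1 : ℝ) : ℂ) *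
          (pairBasis k j (x 0 k) (x 1 k) * star (pairBasis k j (y 0 k) (y 1 k))) =
        (if x 0 k = y 1 k ∧ x 1 k = y 0 k then 1 else 0) *
          if k = k₀ then (ζ (x 0) + ζ (x 1)) / 2 else 1 := by
      intro k
      by_cases hk : k = k₀
      · subst hk
        simp only [if_true, sum_swapSign_mul_averageZ_mul_pairBasis hk₀, hζ]
      · simp only [if_neg hk, mul_one, sum_swapSign_mul_pairBasis]
    simp only [h2]
    rw [Finset.prod_mul_distrib, Finset.prod_ite_eq' Finset.univ k₀]
    simp

/-! ### The ratio estimator and its concentration -/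

/-- The algorithm that measures `F` in each of `T` rounds, adds up the values `X` and `Y` of the
outcomes, starting from `x` and `y`, and outputs the ratio of the second sum to the first. -/
noncomputable def ratioTree {n k : ℕ} {Ω : Type} [Fintype Ω] (F : POVM (Fin k → Qubits n) Ω) (X Y : Ω → ℝ) :
    (T : ℕ) → ℝ → ℝ → LearningTree n k Ω T
  | 0, x, y => .leaf (y / x)
  | T + 1, x, y => .node F fun s => ratioTree F X Y T (x + X s) (y + Y s)

theorem measuresOnly_ratioTree {n k : ℕ} {Ω : Type} [Fintype Ω] (F : POVM (Fin k → Qubits n) Ω)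
    (X Y : Ω → ℝ) (T : ℕ) (x y : ℝ) : (ratioTree F X Y T x y).MeasuresOnly F := by
  induction T generalizing x y with
  | zero => exact trivial
  | succ T ih => exact ⟨rfl, fun s => ih _ _⟩

/-- The centred sample has no cross term with `a` and has variance at most `1`. -/
theorem sum_mul_sq_le_of_mean {Ω : Type} [Fintype Ω] {w X : Ω → ℝ} (hw : ∀ s, 0 ≤ w s)
    (hw1 : ∑ s, w s = 1) (hX : ∀ s, |X s| ≤ 1) {p : ℝ} (hp : ∑ s, w s * X s = p) (a : ℝ) :
    ∑ s, w s * (a + (X s - p)) ^ 2 ≤ a ^ 2 + 1 := by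
  have h : ∑ s, w s * (a + (X s - p)) ^ 2 =
      ∑ s, w s * X s ^ 2 + 2 * (a - p) * ∑ s, w s * X s + (a - p) ^ 2 * ∑ s, w s := by
    rw [Finset.mul_sum, Finset.mul_sum, ← Finset.sum_add_distrib, ← Finset.sum_add_distrib]
    exact Finset.sum_congr rfl fun s _ => by ring
  have h2 : ∑ s, w s * X s ^ 2 ≤ ∑ s, w s :=
    Finset.sum_le_sum fun s _ => by
      have := mul_le_mul_of_nonneg_left ((sq_le_one_iff_abs_le_one _).2 (hX s)) (hw s)
      simpa using this
  rw [h, hp, hw1]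
  nlinarith [sq_nonneg p]

/-- Chebyshev's inequality for the two sums computed by `ratioTree`. -/
theorem le_outputProb_ratioTree {n k : ℕ} {Ω : Type} [Fintype Ω] (F : POVM (Fin k → Qubits n) Ω)
    {X Y : Ω → ℝ} (hX : ∀ s, |X s| ≤ 1) (hY : ∀ s, |Y s| ≤ 1)
    {ρ : Matrix (Qubits n) (Qubits n) ℂ} (hρ : IsDensityMatrix ρ) {p q : ℝ}
    (hp : ∑ s, F.prob (tensorPower k ρ) s * X s = p)
    (hq : ∑ s, F.prob (tensorPower k ρ) s * Y s = q) {S : Set ℝ} {P Q K : ℝ} (hK : 0 < K)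
    (hS : ∀ x y, (x - P) ^ 2 + (y - Q) ^ 2 ≤ K → y / x ∈ S) (T : ℕ) (x y : ℝ) :
    1 - ((x + T * p - P) ^ 2 + (y + T * q - Q) ^ 2 + 2 * T) / K ≤
      (ratioTree F X Y T x y).outputProb ρ S := by
  have hw : ∀ s, 0 ≤ F.prob (tensorPower k ρ) s :=
    F.prob_nonneg (posSemidef_tensorPower k hρ.1)
  have hw1 : ∑ s, F.prob (tensorPower k ρ) s = 1 := by
    rw [F.sum_prob_tensorPower hρ.1, hρ.2, Complex.one_re, one_pow]
  -- The numerator is a potential: the squared distance of the predicted final sums from `(P, Q)`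
  -- plus `2` per remaining round, one unit of variance for each sum. At a leaf this is Markov's
  -- inequality, as the bound is negative outside the good disc.
  induction T generalizing x y with
  | zero =>
    simp only [ratioTree, LearningTree.outputProb, Nat.cast_zero, zero_mul, mul_zero, add_zero]
    by_cases h : (x - P) ^ 2 + (y - Q) ^ 2 ≤ K
    · rw [Set.indicator_of_mem (hS x y h), Pi.one_apply]
      have : 0 ≤ ((x - P) ^ 2 + (y - Q) ^ 2) / K := by positivity
      linarith
    · have h1 : 1 < ((x - P) ^ 2 + (y - Q) ^ 2) / K := by
        rw [lt_div_iff₀ hK]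
        linarith
      have h2 : 0 ≤ S.indicator (1 : ℝ → ℝ) (y / x) :=
        Set.indicator_nonneg (fun _ _ => zero_le_one) _
      linarith
  | succ T ih =>
    simp only [ratioTree, LearningTree.outputProb]
    refine le_trans ?_ (Finset.sum_le_sum fun s _ => mul_le_mul_of_nonneg_left
      (ih (x + X s) (y + Y s)) (hw s))
    have hx := sum_mul_sq_le_of_mean hw hw1 hX hp (x + (T + 1) * p - P)
    have hy := sum_mul_sq_le_of_mean hw hw1 hY hq (y + (T + 1) * q - Q)
    have h : ∑ s, F.prob (tensorPower k ρ) s *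
          (1 - ((x + X s + T * p - P) ^ 2 + (y + Y s + T * q - Q) ^ 2 + 2 * T) / K) =
        ∑ s, F.prob (tensorPower k ρ) s -
          (∑ s, F.prob (tensorPower k ρ) s * (x + (T + 1) * p - P + (X s - p)) ^ 2 +
            ∑ s, F.prob (tensorPower k ρ) s * (y + (T + 1) * q - Q + (Y s - q)) ^ 2 +
            2 * T * ∑ s, F.prob (tensorPower k ρ) s) / K := by
      rw [Finset.mul_sum, ← Finset.sum_add_distrib, ← Finset.sum_add_distrib, Finset.sum_div,
        ← Finset.sum_sub_distrib]
      refine Finset.sum_congr rfl fun s _ => ?_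
      ring
    rw [h, hw1]
    push_cast
    refine sub_le_sub_left (div_le_div_of_nonneg_right ?_ hK.le) 1
    linarith

theorem abs_trace_pauliZ_mul_le {n : ℕ} (k : Fin n) {M : Matrix (Qubits n) (Qubits n) ℂ}
    (hM : M.PosSemidef) : |(pauliZ k * M).trace.re| ≤ M.trace.re := by
  simp only [Matrix.trace, Matrix.diag_apply, pauliZ, Matrix.diagonal_mul, Complex.re_sum]
  refine (Finset.abs_sum_le_sum_abs _ _).trans (Finset.sum_le_sum fun x _ => ?_)
  have h0 : 0 ≤ (M x x).re := (Complex.nonneg_iff.1 hM.diag_nonneg).1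
  split_ifs <;> simp [abs_of_nonneg h0]

/-- Both sums are off by at most `N ε ≤ N p / 10`, so `x ≥ (9 / 10) N p > 0` and the ratio is off by
at most `2 N ε / x ≤ 2 / 9`. -/
theorem abs_div_sub_div_le {p q ε N x y : ℝ} (hN : 0 < N) (hp : 0 < p) (hε : 0 < ε)
    (hεp : 10 * ε ≤ p) (hqp : |q| ≤ p) (h : (x - N * p) ^ 2 + (y - N * q) ^ 2 ≤ (N * ε) ^ 2) :
    |y / x - q / p| ≤ 0.25 := by
  have hx : |x - N * p| ≤ N * ε :=
    abs_le_of_sq_le_sq (by nlinarith [sq_nonneg (y - N * q)]) (by positivity)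
  have hy : |y - N * q| ≤ N * ε :=
    abs_le_of_sq_le_sq (by nlinarith [sq_nonneg (x - N * p)]) (by positivity)
  have hNp : 0 < N * p := mul_pos hN hp
  have hNε : 10 * (N * ε) ≤ N * p := by nlinarith
  have hx0 : 9 / 10 * (N * p) ≤ x := by linarith [(abs_le.1 hx).1]
  have hxpos : 0 < x := by linarith
  have heq : y / x - q / p = ((y - N * q) - q / p * (x - N * p)) / x := by
    field_simp
    ring
  have hr : |q / p| ≤ 1 := by
    rw [abs_div, abs_of_pos hp]
    exact (div_le_one hp).2 hqp
  have hnum : |(y - N * q) - q / p * (x - N * p)| ≤ 2 * (N * ε) := by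
    refine (abs_sub _ _).trans ?_
    rw [abs_mul]
    have := mul_le_mul hr hx (abs_nonneg _) zero_le_one
    linarith
  rw [heq, abs_div, abs_of_pos hxpos, div_le_iff₀ hxpos]
  norm_num
  linarith

theorem predicts_ratioTree {n : ℕ} {k₀ : Fin n} (hk₀ : (k₀ : ℕ) = 0) {γ : ℝ} (hγ : 0 < γ) {N : ℕ}
    (hN : 1000 / γ ^ 4 ≤ N) :
    (ratioTree (virtualDistillationPOVM n) swapValue
      (fun s => swapValue s * averageZ (s k₀)) N 0 0).Predicts
      (pauliZ k₀) γ := by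
  intro ρ hρ hgap
  have hne : Nontrivial (Qubits n) := by
    have : Nonempty (Fin n) := ⟨k₀⟩
    infer_instance
  have hγp := hgap.sq_le_trace_sq hρ.1 hγ
  have hsq : (ρ ^ 2).PosSemidef := hρ.1.pow 2
  have hqp := abs_trace_pauliZ_mul_le k₀ hsq
  have hp := sum_prob_mul_swapValue ρ
  have hq := sum_prob_mul_swapValue_mul_averageZ ρ hk₀
  have hexp : squaredExpectation (pauliZ k₀) ρ =
      (pauliZ k₀ * ρ ^ 2).trace.re / (ρ ^ 2).trace.re := by
    rw [squaredExpectation, trace_eq_re_of_posSemidef hsq, Complex.div_ofReal_re,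
      Complex.ofReal_re]
  rw [hexp]
  set p := (ρ ^ 2).trace.re
  set q := (pauliZ k₀ * ρ ^ 2).trace.re
  have hγ2 : 0 < γ ^ 2 := by positivity
  have hN0 : 0 < (N : ℝ) := lt_of_lt_of_le (by positivity) hN
  have hK : 0 < ((N : ℝ) * (γ ^ 2 / 10)) ^ 2 := by positivity
  have h := le_outputProb_ratioTree (virtualDistillationPOVM n) abs_swapValue_le_one
    (fun s => by
      rw [abs_mul]
      exact mul_le_one₀ (abs_swapValue_le_one s) (abs_nonneg _) (abs_averageZ_le_one _))
    hρ hp hq (S := {x | |x - q / p| ≤ 0.25}) (P := N * p) (Q := N * q) hK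
    (fun x y hxy => abs_div_sub_div_le hN0 (by linarith) (by positivity) (by linarith) hqp hxy)
    N 0 0
  refine le_trans ?_ h
  -- With `ε = γ ^ 2 / 10`, the failure bound is `200 / (N γ ^ 4)`, whence the constant `1000`.
  have h1 : 2 * (N : ℝ) / ((N : ℝ) * (γ ^ 2 / 10)) ^ 2 ≤ 0.2 := by
    rw [div_le_iff₀ (by positivity)] at hN
    rw [div_le_iff₀ hK]
    have := mul_le_mul_of_nonneg_left hN hN0.le
    norm_num
    nlinarith
  rw [zero_add, zero_add, sub_self, sub_self, zero_pow two_ne_zero, zero_add, zero_add]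
  norm_num at h1 ⊢
  linarith

theorem mainTheorem7 :
    -- Upper bound: a number of copies depending only on the gap suffices with quantum memory.
    (∀ γ : ℝ, 0 < γ → ∃ N : ℕ, ∀ (n : ℕ) (hn : 1 < n),
      ∃ A : QuantumEnhancedAlgorithm n 2 (Fin n → Fin 4) N,
        A.MeasuresOnly (virtualDistillationPOVM n) ∧
        A.Predicts (pauliZ ⟨0, by omega⟩) γ) ∧
    -- Lower bound: every conventional algorithm needs order `2 ^ (n / 2)` copies.
    (∃ c : ℝ, 0 < c ∧ ∀ (n : ℕ) (hn : 1 < n) (γ : ℝ), 0 < γ → γ ≤ 1 / 2 - 1 / 2 ^ n →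
      ∀ (Ω : Type) [Fintype Ω] (T : ℕ) (A : ConventionalAlgorithm n Ω T),
        A.Predicts (pauliZ ⟨0, by omega⟩) γ → c * (2 : ℝ) ^ ((n : ℝ) / 2) ≤ (T : ℝ)) := by
  refine ⟨fun γ hγ => ?_, 1 / 2, by norm_num, ?_⟩
  · obtain ⟨N, hN⟩ := exists_nat_ge (1000 / γ ^ 4)
    exact ⟨N, fun n hn => ⟨_, measuresOnly_ratioTree _ _ _ _ _ _, predicts_ratioTree rfl hγ hN⟩⟩
  · intro n hn γ _ hγ Ω _ T A hA
    obtain ⟨m, rfl⟩ : ∃ m, n = m + 1 := ⟨n - 1, by omega⟩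
    exact conventional_lower_bound (by omega) A hγ hA
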